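/- Let $\mathbb D=\{z\in\mathbb C:|z|<1\}$ and let $dA=\frac1\pi\,dx\,dy$. For $1<s<\infty$ let $B^s$ be the analytic Besov space of all $f$ analytic in $\mathbb D$ with $(s-1)\int_{\mathbb D}(1-|z|^2)^{s-2}|f'(z)|^s\,dA(z)<\infty$, and let $H^\infty$ be the space of bounded analytic functions in $\mathbb D$. For $g$ analytic in $\mathbb D$ and $0\le r<1$ put $M_p(r,g)=\left(\frac1{2\pi}\int_0^{2\pi}|g(re^{i\theta})|^p\,d\theta\right)^{1/p}$. **Theorem.** Let $1<q<p<\infty$ and let $\phi$ be a positive increasing (that is, nondecreasing) function on $[0,1)$ with $$\int_0^1(1-r)^{p-2}\phi(r)^p\,dr<\infty\qquad\text{and}\qquad\int_0^1(1-r)^{q-2}\phi(r)^q\,dr=\infty .$$ Then the Hadamard gap series $$f(z)=\sum_{k=0}^\infty 2^{-k}\phi(1-2^{-k})\,z^{2^k}$$ converges in $\mathbb D$ and defines a function $f\in (B^p\cap H^\infty)\setminus B^q$ such that 1. there is a constant $C>0$ with $M_p(r,f')\ge C\,\phi(r)$ for all $r\in[0,1)$; 2. $\int_0^1(1-r)^{q-2}|f'(re^{i\theta})|^q\,dr=\infty$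 for every $\theta\in\mathbb R$. The same holds for the series $\sum_{k=1}^\infty 2^{-k}\phi(1-2^{-k})z^{2^k}$, except that (since the derivative of this function vanishes at $0$) property 1 is replaced by: for every $r_0>0$ there is a constant $C>0$ with $M_p(r,f')\ge C\,\phi(r)$ for all $r\in[r_0,1)$. -/

import Mathlib

open MeasureTheory Set Metric

noncomputable section

/-- The normalized area measure `dA = π⁻¹ dx dy` on the open unit disc of the complex plane,
as a measure on `ℂ` carried by the disc. -/
def discArea : Measure ℂ :=
  ENNReal.ofReal Real.pi⁻¹ • (volume.restrict (ball (0 : ℂ) 1))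

/-- The integral mean `M_p(r, g) = ((2π)⁻¹ ∫_0^{2π} |g(r e^{iθ})|^p dθ)^{1/p}`. -/
def integralMean (p r : ℝ) (g : ℂ → ℂ) : ℝ :=
  ((2 * Real.pi)⁻¹ * ∫ θ in (0 : ℝ)..2 * Real.pi, ‖g (circleMap 0 r θ)‖ ^ p) ^ (1 / p)

/-- The weighted Bergman space `A^p_α`: analytic functions `g` in the unit disc with
`(α + 1) ∫ (1 - |z|²)^α |g(z)|^p dA(z) < ∞`. -/
def MemBergman (p α : ℝ) (g : ℂ → ℂ) : Prop :=
  DifferentiableOn ℂ g (ball 0 1) ∧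
    ENNReal.ofReal (α + 1) *
      ∫⁻ z, ENNReal.ofReal ((1 - ‖z‖ ^ 2) ^ α * ‖g z‖ ^ p) ∂discArea < ⊤

/-- The analytic Besov space `B^p`, `1 < p < ∞`: analytic functions `f` in the unit disc with
`f' ∈ A^p_{p-2}`. -/
def MemBesov (p : ℝ) (f : ℂ → ℂ) : Prop :=
  DifferentiableOn ℂ f (ball 0 1) ∧ MemBergman p (p - 2) (deriv f)

/-- The Hardy space `H^∞`: bounded analytic functions in the unit disc. -/
def MemHInfty (f : ℂ → ℂ) : Prop :=
  DifferentiableOn ℂ f (ball 0 1) ∧ ∃ M : ℝ, ∀ z ∈ ball (0 : ℂ) 1, ‖f z‖ ≤ M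

/-- `∫_0^1 (1 - r)^{s-2} u(r)^s dr` as an extended nonnegative number, for `u ≥ 0` on `[0, 1)`. -/
def radialIntegral (s : ℝ) (u : ℝ → ℝ) : ENNReal :=
  ∫⁻ r in Ico (0 : ℝ) 1, ENNReal.ofReal ((1 - r) ^ (s - 2) * u r ^ s)

/-- The term `2^{-k} φ(1 - 2^{-k}) z^{2^k}` of the Hadamard gap series attached to `φ`. -/
def gapTerm (φ : ℝ → ℝ) (k : ℕ) (z : ℂ) : ℂ :=
  (((2 : ℝ) ^ k)⁻¹ * φ (1 - ((2 : ℝ) ^ k)⁻¹) : ℝ) * z ^ (2 ^ k)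

end

/-! Put a_k = φ(1 - 2^{-k}), so that f' = ∑ a_k z^{2^k-1}. As φ is monotone, ∫ (1-r)^{s-2} φ^s dr is
comparable to ∑ 2^{-k(s-1)} a_k^s; the hypotheses say that this sum converges for s = p and diverges
for s = q. Convergence makes 2^{-k} a_k decay geometrically, so f is bounded.

For 1 - r of order 2^{-n}, r^{2^k-1} is at most a constant times min(1, 2^{n-k}). A Schur test then
bounds the radial p-integrals of f' uniformly in θ (`exists_lintegral_lacunary_le`), and integrating
over θ gives f ∈ B^p.

The hard point is divergence on every radius: with gap ratio 2 no single term need dominate. The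
combination ∑ (-1)^i C(n,i) g(r^{i+1}) of dilates of g = z f' replaces x = r^{2^l} by x(1-x)^n,
which is small both for x near 1 and for x near 0. If 2^{-k} a_k dominates all later 2^{-l} a_l, the
k-th term wins whenever r^{2^k} lies in a fixed window (`IsDominant.le_norm_difference`). Such k
carry at least half of the dyadic sum (`dyadicSum_le_two_mul_dominant`), and dilations change radial
integrals by at most a constant, whence `radialIntegral_lacunary_eq_top`; integrating over θ gives f
∉ B^q.

The bound on M_p is Cauchy's coefficient estimate, using the coefficient of index n + 1 for r in the
n-th dyadic block. -/

noncomputable section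

/-! ### Dyadic discretization of the radial integrals. -/

/-- The dyadic scale `2^{-k}`. -/
def dy (k : ℕ) : ℝ := ((2 : ℝ) ^ k)⁻¹

/-- The dyadic discretization `∑ 2^{-k(s-1)} a_k^s` of `∫_0^1 (1 - r)^{s-2} u(r)^s dr`. -/
def dyadicSum (s : ℝ) (a : ℕ → ℝ) : ENNReal :=
  ∑' k, ENNReal.ofReal (dy k ^ (s - 1) * a k ^ s)

/-- The dyadic intervals `[1 - 2^{-n}, 1 - 2^{-n-1})`, which tile `[0, 1)`. -/
def dyIco (n : ℕ) : Set ℝ := Ico (1 - dy n) (1 - dy (n + 1))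

lemma dy_pos (k : ℕ) : 0 < dy k := by unfold dy; positivity

lemma dy_zero : dy 0 = 1 := by simp [dy]

lemma dy_succ (k : ℕ) : dy (k + 1) = dy k / 2 := by
  unfold dy; rw [pow_succ, mul_inv]; ring

lemma dy_add (k j : ℕ) : dy (k + j) = dy k * dy j := by
  unfold dy; rw [pow_add, mul_inv]

lemma dy_eq_pow (k : ℕ) : dy k = (1 / 2 : ℝ) ^ k := by
  unfold dy; simp

lemma dy_le_one (k : ℕ) : dy k ≤ 1 := by
  rw [dy_eq_pow]; exact pow_le_one₀ (by norm_num) (by norm_num)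

lemma dy_mul_two_pow (k : ℕ) : dy k * 2 ^ k = 1 := by
  unfold dy; exact inv_mul_cancel₀ (by positivity)

lemma one_sub_dy_mem (k : ℕ) : 1 - dy k ∈ Ico (0 : ℝ) 1 :=
  ⟨by linarith [dy_le_one k], by linarith [dy_pos k]⟩

lemma monotone_one_sub_dy : Monotone fun k => 1 - dy k :=
  monotone_nat_of_le_succ fun n => by rw [dy_succ]; linarith [dy_pos n]

lemma iUnion_dyIco : ⋃ n, dyIco n = Ico (0 : ℝ) 1 := by
  ext r
  simp only [mem_iUnion, dyIco, mem_Ico]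
  constructor
  · rintro ⟨n, h1, h2⟩
    exact ⟨by linarith [dy_le_one n], by linarith [dy_pos (n + 1)]⟩
  · rintro ⟨h0, h1⟩
    obtain ⟨n, hn1, hn2⟩ := exists_nat_pow_near_of_lt_one (x := 1 - r) (y := 1 / 2)
      (by linarith) (by linarith) (by norm_num) (by norm_num)
    refine ⟨n, ?_, ?_⟩
    · rw [dy_eq_pow]; linarith
    · rw [dy_eq_pow]; linarith

lemma pairwise_disjoint_dyIco : Pairwise (Function.onFun Disjoint dyIco) :=
  monotone_one_sub_dy.pairwise_disjoint_on_Ico_succ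

lemma lintegral_Ico_eq_tsum_dyIco (F : ℝ → ENNReal) :
    ∫⁻ r in Ico (0 : ℝ) 1, F r = ∑' n, ∫⁻ r in dyIco n, F r := by
  rw [← iUnion_dyIco]
  exact lintegral_iUnion (fun _ => measurableSet_Ico) pairwise_disjoint_dyIco F

lemma volume_dyIco (n : ℕ) : volume (dyIco n) = ENNReal.ofReal (dy n / 2) := by
  rw [dyIco, Real.volume_Ico, dy_succ]; congr 1; ring

lemma dyIco_subset (n : ℕ) : dyIco n ⊆ Ico 0 1 := iUnion_dyIco ▸ subset_iUnion dyIco n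

lemma rpow_sub_two_eq {t : ℝ} (ht : 0 < t) (s : ℝ) : t ^ (s - 2) = t ^ s / t ^ 2 := by
  rw [Real.rpow_sub ht, Real.rpow_two]

lemma rpow_sub_one_eq {t : ℝ} (ht : 0 < t) (s : ℝ) : t ^ (s - 1) = t ^ s / t := by
  rw [Real.rpow_sub ht, Real.rpow_one]

/-- The exponent s - 2 may have either sign, so t^s and t^2 are bounded separately. -/
lemma rpow_sub_two_le {c t b s : ℝ} (hc : 0 < c) (hct : c ≤ t) (htb : t ≤ b) (hs : 0 ≤ s) :
    t ^ (s - 2) ≤ b ^ s / c ^ 2 := by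
  have ht := hc.trans_le hct
  rw [rpow_sub_two_eq ht]
  have := Real.rpow_le_rpow ht.le htb hs
  have hb := ht.trans_le htb
  gcongr

lemma le_rpow_sub_two {c t b s : ℝ} (hc : 0 < c) (hct : c ≤ t) (htb : t ≤ b) (hs : 0 ≤ s) :
    c ^ s / b ^ 2 ≤ t ^ (s - 2) := by
  have ht := hc.trans_le hct
  rw [rpow_sub_two_eq ht]
  have := Real.rpow_le_rpow hc.le hct hs
  gcongr

lemma dyadicSum_le_radialIntegral {s : ℝ} (hs : 0 ≤ s) {φ : ℝ → ℝ} {a : ℕ → ℝ}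
    (ha0 : ∀ n, 0 ≤ a n) (ha : ∀ n, ∀ r ∈ dyIco n, a n ≤ φ r) :
    dyadicSum s a ≤ ENNReal.ofReal (2 ^ s * 2) * radialIntegral s φ := by
  unfold dyadicSum radialIntegral
  rw [lintegral_Ico_eq_tsum_dyIco, ← ENNReal.tsum_mul_left]
  refine ENNReal.tsum_le_tsum fun n => ?_
  have hd := dy_pos n
  have key : ∀ r ∈ dyIco n, ENNReal.ofReal ((dy n / 2) ^ s / dy n ^ 2 * a n ^ s) ≤
      ENNReal.ofReal ((1 - r) ^ (s - 2) * φ r ^ s) := by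
    intro r hr
    apply ENNReal.ofReal_le_ofReal
    have h2 := hr.2
    rw [dy_succ] at h2
    have := le_rpow_sub_two (c := dy n / 2) (t := 1 - r) (b := dy n) (s := s) (by positivity)
      (by linarith) (by linarith [hr.1]) hs
    have h3 := Real.rpow_le_rpow (ha0 n) (ha n r hr) hs
    have := Real.rpow_nonneg (ha0 n) s
    have : 0 < (1 - r) ^ (s - 2) := Real.rpow_pos_of_pos (by linarith) _
    gcongr
  calc _ = ENNReal.ofReal (2 ^ s * 2) *
        ∫⁻ r in dyIco n, ENNReal.ofReal ((dy n / 2) ^ s / dy n ^ 2 * a n ^ s) := by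
        rw [setLIntegral_const, volume_dyIco, ← ENNReal.ofReal_mul' (by positivity),
          ← ENNReal.ofReal_mul (by positivity), Real.div_rpow hd.le (by norm_num),
          rpow_sub_one_eq hd]
        congr 1
        field_simp
    _ ≤ _ := by
        exact mul_le_mul' le_rfl (setLIntegral_mono' measurableSet_Ico key)

lemma radialIntegral_le_tsum {s : ℝ} (hs : 0 ≤ s) {φ : ℝ → ℝ} {a : ℕ → ℝ}
    (hφ : ∀ r ∈ Ico (0 : ℝ) 1, 0 ≤ φ r) (ha : ∀ n, ∀ r ∈ dyIco n, φ r ≤ a n) :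
    radialIntegral s φ ≤ 2 * dyadicSum s a := by
  unfold dyadicSum radialIntegral
  rw [lintegral_Ico_eq_tsum_dyIco, ← ENNReal.tsum_mul_left]
  refine ENNReal.tsum_le_tsum fun n => ?_
  have hd := dy_pos n
  have key : ∀ r ∈ dyIco n, ENNReal.ofReal ((1 - r) ^ (s - 2) * φ r ^ s) ≤
      ENNReal.ofReal (dy n ^ s / (dy n / 2) ^ 2 * a n ^ s) := by
    intro r hr
    apply ENNReal.ofReal_le_ofReal
    have h2 := hr.2
    rw [dy_succ] at h2
    have := rpow_sub_two_le (c := dy n / 2) (t := 1 - r) (b := dy n) (s := s) (by positivity)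
      (by linarith) (by linarith [hr.1]) hs
    have h0 := hφ r (dyIco_subset n hr)
    have h3 := Real.rpow_le_rpow h0 (ha n r hr) hs
    have := Real.rpow_nonneg h0 s
    gcongr
  calc _ ≤ ∫⁻ r in dyIco n, ENNReal.ofReal (dy n ^ s / (dy n / 2) ^ 2 * a n ^ s) :=
        setLIntegral_mono' measurableSet_Ico key
    _ = _ := by
        rw [setLIntegral_const, volume_dyIco, ← ENNReal.ofReal_mul' (by positivity),
          rpow_sub_one_eq hd, ← ENNReal.ofReal_ofNat, ← ENNReal.ofReal_mul (by positivity)]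
        congr 1
        field_simp

/-- A monotone φ is bounded on block n by its sample at the right endpoint, of index n + 1; this
moves the index back. -/
lemma dyadicSum_shift_le (s : ℝ) (a : ℕ → ℝ) :
    dyadicSum s (fun n => a (n + 1)) ≤ ENNReal.ofReal (2 ^ (s - 1)) * dyadicSum s a := by
  unfold dyadicSum
  rw [← ENNReal.tsum_mul_left]
  refine le_trans (ENNReal.tsum_le_tsum fun n => ?_) (ENNReal.tsum_comp_le_tsum_of_injective
    (add_left_injective 1) fun n => ENNReal.ofReal (2 ^ (s - 1)) *
      ENNReal.ofReal (dy n ^ (s - 1) * a n ^ s))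
  rw [← ENNReal.ofReal_mul (by positivity), dy_succ, ← mul_assoc,
    ← Real.mul_rpow (by norm_num) (by linarith [dy_pos n])]
  apply le_of_eq
  congr 4
  ring

/-- Finiteness of the dyadic sum bounds the coefficients geometrically. -/
lemma summable_dy_mul {p : ℝ} (hp : 1 < p) {a : ℕ → ℝ} (ha : ∀ n, 0 ≤ a n)
    (h : dyadicSum p a < ⊤) : Summable fun k => dy k * a k := by
  set M := (dyadicSum p a).toReal
  have h1 : ∀ k, dy k ^ (p - 1) * a k ^ p ≤ M := fun k => by
    rw [← ENNReal.ofReal_le_iff_le_toReal h.ne]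
    exact ENNReal.le_tsum k
  have hM : 0 ≤ M := ENNReal.toReal_nonneg
  -- A single term bounded by M means (2^{-k} a_k)^p ≤ M 2^{-k}; take p-th roots.
  have h2 : ∀ k, dy k * a k ≤ M ^ p⁻¹ * ((1 / 2 : ℝ) ^ p⁻¹) ^ k := fun k => by
    have hd := dy_pos k
    have : (dy k * a k) ^ p ≤ M * (1 / 2 : ℝ) ^ k := by
      have := mul_le_mul_of_nonneg_left (h1 k) hd.le
      rw [rpow_sub_one_eq hd] at this
      rw [Real.mul_rpow hd.le (ha k), ← dy_eq_pow, mul_comm M]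
      refine le_trans (le_of_eq ?_) this
      field_simp
    have h3 := Real.rpow_le_rpow (by have := ha k; positivity) this (by positivity : 0 ≤ p⁻¹)
    rw [Real.rpow_rpow_inv (by have := ha k; positivity) (by linarith),
      Real.mul_rpow hM (by positivity)] at h3
    rwa [← Real.rpow_natCast, ← Real.rpow_mul (by norm_num), mul_comm p⁻¹, Real.rpow_mul (by norm_num),
      Real.rpow_natCast]
  refine Summable.of_nonneg_of_le (fun k => mul_nonneg (dy_pos k).le (ha k)) h2 ?_
  refine Summable.mul_left _ (summable_geometric_of_lt_one (by positivity) ?_)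
  exact Real.rpow_lt_one (by norm_num) (by norm_num) (by positivity)

/-! ### The gap series and its derivative. -/

/-- The gap series `∑ 2^{-k} a_k z^{2^k}`. -/
def gapSeries (a : ℕ → ℝ) (z : ℂ) : ℂ := ∑' k, ((dy k * a k : ℝ) : ℂ) * z ^ (2 ^ k)

lemma norm_gap_le {a : ℕ → ℝ} (ha : ∀ k, 0 ≤ a k) {z : ℂ} (hz : z ∈ ball (0 : ℂ) 1) (k : ℕ) :
    ‖((dy k * a k : ℝ) : ℂ) * z ^ (2 ^ k)‖ ≤ dy k * a k := by
  have h := mul_nonneg (dy_pos k).le (ha k)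
  rw [norm_mul, Complex.norm_real, Real.norm_of_nonneg h, norm_pow]
  exact mul_le_of_le_one_right h
    (pow_le_one₀ (norm_nonneg z) (mem_ball_zero_iff.1 hz).le)

lemma differentiableOn_gap (a : ℕ → ℝ) (k : ℕ) :
    DifferentiableOn ℂ (fun z : ℂ => ((dy k * a k : ℝ) : ℂ) * z ^ (2 ^ k)) (ball 0 1) := by
  fun_prop

lemma hasSum_gapSeries {a : ℕ → ℝ} (ha : ∀ k, 0 ≤ a k) (hs : Summable fun k => dy k * a k)
    {z : ℂ} (hz : z ∈ ball (0 : ℂ) 1) :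
    HasSum (fun k => ((dy k * a k : ℝ) : ℂ) * z ^ (2 ^ k)) (gapSeries a z) :=
  (Summable.of_norm_bounded hs (norm_gap_le ha hz)).hasSum

lemma differentiableOn_gapSeries {a : ℕ → ℝ} (ha : ∀ k, 0 ≤ a k) (hs : Summable fun k => dy k * a k) :
    DifferentiableOn ℂ (gapSeries a) (ball 0 1) :=
  Complex.differentiableOn_tsum_of_summable_norm hs (differentiableOn_gap a) isOpen_ball
    fun k _ hz => norm_gap_le ha hz k

lemma memHInfty_gapSeries {a : ℕ → ℝ} (ha : ∀ k, 0 ≤ a k) (hs : Summable fun k => dy k * a k) :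
    MemHInfty (gapSeries a) :=
  ⟨differentiableOn_gapSeries ha hs, ∑' k, dy k * a k, fun _ hz =>
    tsum_of_norm_bounded hs.hasSum (norm_gap_le ha hz)⟩

lemma hasSum_deriv_gapSeries {a : ℕ → ℝ} (ha : ∀ k, 0 ≤ a k) (hs : Summable fun k => dy k * a k)
    {z : ℂ} (hz : z ∈ ball (0 : ℂ) 1) :
    HasSum (fun k => (a k : ℂ) * z ^ (2 ^ k - 1)) (deriv (gapSeries a) z) := by
  have h := Complex.hasSum_deriv_of_summable_norm hs (differentiableOn_gap a) isOpen_ball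
    (fun k _ hz => norm_gap_le ha hz k) hz
  convert! h using 2 with k
  rw [deriv_const_mul_field, deriv_pow_field, ← mul_assoc]
  have : ((dy k : ℝ) : ℂ) * 2 ^ k = 1 := by
    rw [← Complex.ofReal_one, ← dy_mul_two_pow k]; push_cast; rfl
  push_cast
  linear_combination -(a k : ℂ) * z ^ (2 ^ k - 1) * this

lemma differentiableOn_deriv_gapSeries {a : ℕ → ℝ} (ha : ∀ k, 0 ≤ a k) (hs : Summable fun k => dy k * a k) :
    DifferentiableOn ℂ (deriv (gapSeries a)) (ball 0 1) :=
  (differentiableOn_gapSeries ha hs).deriv isOpen_ball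

/-! ### Upper bound for radial integrals by a Schur test. -/

/-- Hölder's inequality after splitting w = w^{1-1/p} w^{1/p}, so that only the total weight enters.
-/
lemma rpow_tsum_weight_mul_le {p : ℝ} (hp : 1 ≤ p) (w f : ℕ → ENNReal) :
    (∑' i, w i * f i) ^ p ≤ (∑' i, w i) ^ (p - 1) * ∑' i, w i * f i ^ p := by
  have hp0 : 0 < p := by linarith
  have h : ∑' i, w i * f i ≤ (∑' i, w i) ^ (1 - p⁻¹) * (∑' i, w i * f i ^ p) ^ p⁻¹ := by
    rw [ENNReal.tsum_eq_iSup_sum]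
    refine iSup_le fun s => (ENNReal.inner_le_weight_mul_Lp_of_nonneg s hp w f).trans ?_
    have h1 : 0 ≤ 1 - p⁻¹ := by
      have := inv_le_one_of_one_le₀ hp
      linarith
    have h2 : 0 ≤ p⁻¹ := by positivity
    exact mul_le_mul' (ENNReal.rpow_le_rpow (ENNReal.sum_le_tsum s) h1)
      (ENNReal.rpow_le_rpow (ENNReal.sum_le_tsum s) h2)
  refine (ENNReal.rpow_le_rpow h hp0.le).trans (le_of_eq ?_)
  rw [ENNReal.mul_rpow_of_nonneg _ _ hp0.le, ENNReal.rpow_inv_rpow hp0.ne', ← ENNReal.rpow_mul]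
  congr 2
  field_simp

/-- The Schur test for nonnegative kernels on `ℓ^p`. -/
lemma tsum_rpow_tsum_mul_le {p : ℝ} (hp : 1 ≤ p) (K : ℕ → ℕ → ENNReal) (A : ENNReal)
    (h1 : ∀ n, ∑' k, K n k ≤ A) (h2 : ∀ k, ∑' n, K n k ≤ A) (u : ℕ → ENNReal) :
    ∑' n, (∑' k, K n k * u k) ^ p ≤ A ^ (p - 1) * (A * ∑' k, u k ^ p) := by
  calc ∑' n, (∑' k, K n k * u k) ^ p
      ≤ ∑' n, A ^ (p - 1) * ∑' k, K n k * u k ^ p := by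
        refine ENNReal.tsum_le_tsum fun n => (rpow_tsum_weight_mul_le hp _ _).trans ?_
        exact mul_le_mul' (ENNReal.rpow_le_rpow (h1 n) (by linarith)) le_rfl
    _ = A ^ (p - 1) * ∑' k, (∑' n, K n k) * u k ^ p := by
        rw [ENNReal.tsum_mul_left, ENNReal.tsum_comm]
        simp_rw [ENNReal.tsum_mul_right]
    _ ≤ _ := by
        rw [← ENNReal.tsum_mul_left (a := A)]
        exact mul_le_mul' le_rfl (ENNReal.tsum_le_tsum fun k => mul_le_mul' (h2 k) le_rfl)

lemma tsum_pow_dist_le (x : ENNReal) (n : ℕ) :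
    ∑' k, x ^ Nat.dist n k ≤ 2 * (1 - x)⁻¹ := by
  rw [← ENNReal.summable.sum_add_tsum_nat_add' (k := n), two_mul, ← ENNReal.tsum_geometric]
  refine add_le_add ?_ (ENNReal.tsum_le_tsum fun i => ?_)
  · calc ∑ i ∈ Finset.range n, x ^ Nat.dist n i
        = ∑ i ∈ Finset.range n, x ^ (i + 1) := by
          rw [← Finset.sum_range_reflect]
          refine Finset.sum_congr rfl fun i hi => ?_
          have := Finset.mem_range.1 hi
          congr 1
          rw [Nat.dist_eq_sub_of_le_right (by omega)]
          omega
      _ ≤ ∑' i, x ^ (i + 1) := ENNReal.sum_le_tsum _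
      _ ≤ ∑' i, x ^ i := ENNReal.tsum_comp_le_tsum_of_injective (add_left_injective 1) (x ^ ·)
  · rw [Nat.dist_eq_sub_of_le (by omega)]
    simp

/-- `r^{N-1}` is at most `1 / (N (1 - r))`. -/
lemma pow_pred_mul_le {r : ℝ} (h0 : 0 ≤ r) (h1 : r < 1) {N : ℕ} :
    N * (1 - r) * r ^ (N - 1) ≤ 1 := by
  -- Each of the N terms of the geometric sum is at least r^{N-1}.
  have h : (N : ℝ) * r ^ (N - 1) ≤ ∑ i ∈ Finset.range N, r ^ i := by
    rw [← nsmul_eq_mul, ← Finset.card_range N, ← Finset.sum_const]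
    rw [Finset.card_range]
    refine Finset.sum_le_sum fun i hi => pow_le_pow_of_le_one h0 h1.le ?_
    have := Finset.mem_range.1 hi
    omega
  have h2 := mul_neg_geom_sum r N
  have h3 : 0 ≤ r ^ N := by positivity
  nlinarith

lemma pow_two_pow_pred_le {r : ℝ} {n : ℕ} (hr : r ∈ dyIco n) (k : ℕ) :
    r ^ (2 ^ k - 1) ≤ min 1 (2 * dy k / dy n) := by
  have hr' := dyIco_subset n hr
  have hn := dy_pos n
  refine le_min (pow_le_one₀ hr'.1 hr'.2.le) ?_
  have h := pow_pred_mul_le hr'.1 hr'.2 (N := 2 ^ k)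
  have h2 := hr.2
  rw [dy_succ] at h2
  push_cast at h
  have h3 : 2 ^ k * (dy n / 2) * r ^ (2 ^ k - 1) ≤ 1 := by
    refine le_trans ?_ h
    have := hr'.1
    gcongr
    linarith
  rw [le_div_iff₀ hn]
  have h4 := mul_le_mul_of_nonneg_left h3 (dy_pos k).le
  have h5 := dy_mul_two_pow k
  calc r ^ (2 ^ k - 1) * dy n = 2 * ((dy k * 2 ^ k) * (dy n / 2) * r ^ (2 ^ k - 1)) := by
        rw [h5]; ring
    _ ≤ 2 * dy k := by linarith

/-- The off-diagonal decay of the matrix that controls `r^{2^k-1}` on `[1 - 2^{-n}, 1 - 2^{-n-1})`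
after both sides are weighted by `2^{-kγ}`. -/
lemma dy_rpow_mul_min_le {γ δ : ℝ} (hδγ : δ ≤ γ) (hδ : δ ≤ 1 - γ) (n k : ℕ) :
    dy n ^ γ * min 1 (2 * dy k / dy n) ≤ 2 * ((1 / 2 : ℝ) ^ δ) ^ Nat.dist n k * dy k ^ γ := by
  have hp : ∀ (e : ℝ) (j : ℕ), ((1 / 2 : ℝ) ^ e) ^ j = dy j ^ e := fun e j => by
    rw [← Real.rpow_natCast, ← Real.rpow_mul (by norm_num), mul_comm, Real.rpow_mul (by norm_num),
      Real.rpow_natCast, ← dy_eq_pow]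
  -- For k = n - j the ratio of the weights gains 2^{-jγ}. For k = n + j the power of r gains 2^{-j}
  -- and the weights lose 2^{jγ}.
  rcases le_total k n with h | h
  · obtain ⟨j, rfl⟩ := Nat.exists_eq_add_of_le h
    rw [Nat.dist_eq_sub_of_le_right h, Nat.add_sub_cancel_left, hp, dy_add,
      Real.mul_rpow (dy_pos k).le (dy_pos j).le]
    have h1 : dy j ^ γ ≤ dy j ^ δ := Real.rpow_le_rpow_of_exponent_ge (dy_pos j) (dy_le_one j) hδγ
    have hj := Real.rpow_nonneg (dy_pos j).le γ
    have hk := Real.rpow_nonneg (dy_pos k).le γ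
    calc _ ≤ dy k ^ γ * dy j ^ γ * 1 := by gcongr; exact min_le_left _ _
      _ ≤ 2 * dy j ^ δ * dy k ^ γ := by nlinarith
  · obtain ⟨j, rfl⟩ := Nat.exists_eq_add_of_le h
    rw [Nat.dist_eq_sub_of_le h, Nat.add_sub_cancel_left, hp, dy_add,
      Real.mul_rpow (dy_pos n).le (dy_pos j).le]
    have hj := dy_pos j
    have hn := dy_pos n
    have h1 : dy j ^ (1 - γ) ≤ dy j ^ δ :=
      Real.rpow_le_rpow_of_exponent_ge hj (dy_le_one j) hδ
    have hj' := Real.rpow_pos_of_pos hj γ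
    have hn' := Real.rpow_pos_of_pos hn γ
    rw [Real.rpow_sub hj, Real.rpow_one, div_le_iff₀ hj'] at h1
    calc _ ≤ dy n ^ γ * (2 * (dy n * dy j) / dy n) := by gcongr; exact min_le_right _ _
      _ = 2 * dy n ^ γ * dy j := by field_simp
      _ ≤ 2 * dy n ^ γ * (dy j ^ δ * dy j ^ γ) := by gcongr
      _ = _ := by ring

/-- The radial `L^p` bound for the derivative of a gap series, uniform over the unimodular twists
of the coefficients. -/
lemma exists_lintegral_lacunary_le {p : ℝ} (hp : 1 < p) :
    ∃ C : ENNReal, C ≠ ⊤ ∧ ∀ (a : ℕ → ℝ) (c : ℕ → ℂ) (d : ℝ → ℂ), (∀ k, 0 ≤ a k) →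
      (∀ k, ‖c k‖ = a k) →
      (∀ r ∈ Ico (0 : ℝ) 1, HasSum (fun k => c k * (r : ℂ) ^ (2 ^ k - 1)) (d r)) →
      radialIntegral p (fun r => ‖d r‖) ≤ C * dyadicSum p a := by
  have hp0 : 0 < p := by linarith
  -- Chosen so that (2^{-kγ} a_k)^p is the k-th term of the dyadic sum; 0 < γ < 1 gives decay on
  -- both sides of the diagonal.
  set γ : ℝ := 1 - p⁻¹ with hγ
  have hpi : p⁻¹ < 1 := inv_lt_one_of_one_lt₀ hp
  have hpi0 : 0 < p⁻¹ := by positivity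
  set δ : ℝ := min γ (1 - γ) with hδ
  have hδ0 : 0 < δ := lt_min (by linarith) (by linarith)
  set x : ENNReal := ENNReal.ofReal ((1 / 2 : ℝ) ^ δ) with hx
  have hx1 : x < 1 := by
    rw [hx, ENNReal.ofReal_lt_one]
    exact Real.rpow_lt_one (by norm_num) (by norm_num) hδ0
  set A : ENNReal := 2 * (1 - x)⁻¹ with hA
  have hAt : A ≠ ⊤ := ENNReal.mul_ne_top (by simp) (by simp [tsub_eq_zero_iff_le, hx1])
  refine ⟨2 * (2 ^ p * (A ^ (p - 1) * A)), ?_, fun a c d ha hc hd => ?_⟩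
  · have h1 : A ^ (p - 1) ≠ ⊤ := ENNReal.rpow_ne_top_of_nonneg (by linarith) hAt
    have h2 : (2 : ENNReal) ^ p ≠ ⊤ := ENNReal.rpow_ne_top_of_nonneg hp0.le (by simp)
    exact ENNReal.mul_ne_top (by simp) (ENNReal.mul_ne_top h2 (ENNReal.mul_ne_top h1 hAt))
  set v : ℕ → ENNReal := fun n => ∑' k, ENNReal.ofReal (a k * min 1 (2 * dy k / dy n)) with hv
  have hdv : ∀ n, ∀ r ∈ dyIco n, ENNReal.ofReal ‖d r‖ ≤ v n := fun n r hr => by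
    rw [ofReal_norm, ← (hd r (dyIco_subset n hr)).tsum_eq]
    refine enorm_tsum_le_tsum_enorm.trans (ENNReal.tsum_le_tsum fun k => ?_)
    rw [← ofReal_norm, norm_mul, hc, norm_pow, Complex.norm_real,
      Real.norm_of_nonneg (dyIco_subset n hr).1]
    exact ENNReal.ofReal_le_ofReal
      (mul_le_mul_of_nonneg_left (pow_two_pow_pred_le hr k) (ha k))
  set u : ℕ → ENNReal := fun k => ENNReal.ofReal (dy k ^ γ * a k) with hu
  have hup : ∀ k, u k ^ p = ENNReal.ofReal (dy k ^ (p - 1) * a k ^ p) := fun k => by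
    have := Real.rpow_nonneg (dy_pos k).le γ
    rw [hu, ENNReal.ofReal_rpow_of_nonneg (mul_nonneg this (ha k)) hp0.le,
      Real.mul_rpow this (ha k), ← Real.rpow_mul (dy_pos k).le]
    congr 3
    rw [hγ]; field_simp
  have hKu : ∀ n, ENNReal.ofReal (dy n ^ γ) * v n ≤ 2 * ∑' k, x ^ Nat.dist n k * u k := fun n => by
    rw [hv, ← ENNReal.tsum_mul_left, ← ENNReal.tsum_mul_left]
    refine ENNReal.tsum_le_tsum fun k => ?_
    have h2 : (2 : ENNReal) = ENNReal.ofReal 2 := by simp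
    rw [h2, hx, ← ENNReal.ofReal_pow (by positivity),
      ← ENNReal.ofReal_mul (Real.rpow_nonneg (dy_pos n).le γ),
      show u k = ENNReal.ofReal (dy k ^ γ * a k) from rfl, ← ENNReal.ofReal_mul (by positivity),
      ← ENNReal.ofReal_mul (by norm_num)]
    refine ENNReal.ofReal_le_ofReal ?_
    have := mul_le_mul_of_nonneg_left
      (dy_rpow_mul_min_le (min_le_left γ (1 - γ)) (min_le_right γ (1 - γ)) n k) (ha k)
    calc _ = a k * (dy n ^ γ * min 1 (2 * dy k / dy n)) := by ring
      _ ≤ _ := this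
      _ = _ := by ring
  have hblock : ∀ n, ∫⁻ r in dyIco n, ENNReal.ofReal ((1 - r) ^ (p - 2) * ‖d r‖ ^ p) ≤
      2 * (ENNReal.ofReal (dy n ^ γ) * v n) ^ p := fun n => by
    have hn := dy_pos n
    calc _ ≤ ∫⁻ r in dyIco n, ENNReal.ofReal (dy n ^ p / (dy n / 2) ^ 2) * v n ^ p := by
          refine setLIntegral_mono' measurableSet_Ico fun r hr => ?_
          have h2 := hr.2
          rw [dy_succ] at h2
          rw [ENNReal.ofReal_mul (Real.rpow_nonneg (by linarith) _),
            ← ENNReal.ofReal_rpow_of_nonneg (norm_nonneg _) hp0.le]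
          refine mul_le_mul' (ENNReal.ofReal_le_ofReal ?_)
            (ENNReal.rpow_le_rpow (hdv n r hr) hp0.le)
          exact rpow_sub_two_le (by positivity) (by linarith) (by linarith [hr.1]) hp0.le
      _ = _ := by
          rw [setLIntegral_const, volume_dyIco, ENNReal.mul_rpow_of_nonneg _ _ hp0.le,
            ENNReal.ofReal_rpow_of_nonneg (Real.rpow_nonneg hn.le _) hp0.le,
            ← Real.rpow_mul hn.le, mul_right_comm, ← ENNReal.ofReal_mul (by positivity),
            ← mul_assoc, show (2 : ENNReal) = ENNReal.ofReal 2 by simp,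
            ← ENNReal.ofReal_mul (by norm_num)]
          congr 2
          rw [show γ * p = p - 1 by rw [hγ]; field_simp, rpow_sub_one_eq hn]
          field_simp
  unfold radialIntegral
  rw [lintegral_Ico_eq_tsum_dyIco]
  calc _ ≤ ∑' n, 2 * (2 ^ p * (∑' k, x ^ Nat.dist n k * u k) ^ p) := by
        refine ENNReal.tsum_le_tsum fun n => (hblock n).trans ?_
        rw [← ENNReal.mul_rpow_of_nonneg _ _ hp0.le]
        exact mul_le_mul' le_rfl (ENNReal.rpow_le_rpow (hKu n) hp0.le)
    _ ≤ 2 * (2 ^ p * (A ^ (p - 1) * (A * ∑' k, u k ^ p))) := by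
        rw [ENNReal.tsum_mul_left, ENNReal.tsum_mul_left]
        refine mul_le_mul' le_rfl (mul_le_mul' le_rfl (tsum_rpow_tsum_mul_le hp.le _ A
          (tsum_pow_dist_le x) (fun k => ?_) u))
        simp_rw [Nat.dist_comm _ k]
        exact tsum_pow_dist_le x k
    _ = _ := by
        rw [tsum_congr hup, ← dyadicSum]
        ring

/-! ### Lower bound at dominant indices by differences of dilates. -/

/-- Squaring y multiplies 1 - y by 1 + y, and every y^{2^i} with i < j is at least s because its
square is at least y^{2^j} ≥ s^2. -/
lemma one_sub_mul_pow_le {s y : ℝ} (hs : 0 ≤ s) (hy0 : 0 ≤ y) (hy1 : y ≤ 1) (j : ℕ)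
    (h : s ^ 2 ≤ y ^ (2 ^ j)) : (1 - y) * (1 + s) ^ j ≤ 1 - y ^ (2 ^ j) := by
  induction j generalizing y with
  | zero => simp
  | succ j ih =>
    have hyy : y ^ (2 ^ (j + 1)) = (y ^ 2) ^ (2 ^ j) := by rw [← pow_mul]; congr 1; ring
    rw [hyy] at h ⊢
    have h2 : y ^ 2 ≤ 1 := pow_le_one₀ hy0 hy1
    have h3 := ih (by positivity) h2 h
    have h4 : s ^ 2 ≤ y ^ 2 := h.trans (pow_le_of_le_one (by positivity) h2 (by positivity))
    have h5 : s ≤ y := by nlinarith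
    calc (1 - y) * (1 + s) ^ (j + 1) = (1 - y) * (1 + s) * (1 + s) ^ j := by ring
      _ ≤ (1 - y ^ 2) * (1 + s) ^ j := by
          have : 0 ≤ (1 - y) * (y - s) := mul_nonneg (by linarith) (by linarith)
          gcongr
          nlinarith
      _ ≤ _ := h3

/-- The `n`-th order differences of a lacunary series along the dilations `r ↦ r^{i+1}`. -/
lemma hasSum_binomial_difference {c : ℕ → ℂ} {g : ℝ → ℂ}
    (hg : ∀ r ∈ Ico (0 : ℝ) 1, HasSum (fun l => c l * (r : ℂ) ^ (2 ^ l)) (g r))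
    {r : ℝ} (hr : r ∈ Ico (0 : ℝ) 1) (n : ℕ) :
    HasSum (fun l => c l * ((r ^ (2 ^ l) * (1 - r ^ (2 ^ l)) ^ n : ℝ) : ℂ))
      (∑ i ∈ Finset.range (n + 1), (-1 : ℂ) ^ i * (n.choose i) * g (r ^ (i + 1))) := by
  have h := hasSum_sum (s := Finset.range (n + 1)) fun i _ =>
    (hg (r ^ (i + 1)) ⟨by have := hr.1; positivity, pow_lt_one₀ hr.1 hr.2 (by omega)⟩).mul_left
      ((-1 : ℂ) ^ i * (n.choose i))
  refine h.congr_fun fun l => ?_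
  have hb : (1 - (r : ℂ) ^ (2 ^ l)) ^ n =
      ∑ i ∈ Finset.range (n + 1), (-(r : ℂ) ^ (2 ^ l)) ^ i * (n.choose i) := by
    rw [sub_eq_add_neg, add_comm, add_pow]
    simp
  push_cast
  rw [hb, Finset.mul_sum, Finset.mul_sum]
  refine Finset.sum_congr rfl fun i _ => ?_
  rw [neg_pow, ← pow_mul, ← pow_mul]
  ring

/-- The coefficient `a k` dominates all its successors at the geometric rate `2`. -/
def IsDominant (a : ℕ → ℝ) (k : ℕ) : Prop := ∀ j, dy (k + j) * a (k + j) ≤ dy k * a k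

lemma IsDominant.le {a : ℕ → ℝ} {k : ℕ} (h : IsDominant a k) (j : ℕ) : a (k + j) ≤ 2 ^ j * a k := by
  have h1 := h j
  have hk := dy_pos k
  rw [dy_add, mul_assoc] at h1
  have h2 := le_of_mul_le_mul_left h1 hk
  calc a (k + j) = 2 ^ j * (dy j * a (k + j)) := by
        rw [← mul_assoc, mul_comm (2 ^ j), dy_mul_two_pow, one_mul]
    _ ≤ _ := by gcongr

/-- The k-th term has modulus a_k x(1-x)^n, and the terms before it and those after it each sum to
at most a quarter of that. Before k, monotonicity gives a_l ≤ a_k and the factor (1 - r^{2^l})^n is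
at most (1-x)^n θ^{k-l}, with θ ≤ s^2/8 by `hn1`. After k, dominance allows growth 2^j against
x^{2^j}. The bound `hn2` keeps (1-x)^n ≥ 1/2. -/
lemma IsDominant.le_norm_difference {a : ℕ → ℝ} (ha : ∀ k, 0 ≤ a k) (hmono : Monotone a)
    {c : ℕ → ℂ} (hc : ∀ k, ‖c k‖ = a k) {k : ℕ} (hk : IsDominant a k) {s : ℝ} (hs : 0 < s)
    (hs1 : s ≤ 1 / 16) {n : ℕ} (hn1 : 8 ≤ s ^ 2 * (1 + s) ^ n) (hn2 : 8 * n * s ^ 2 ≤ 1)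
    {r : ℝ} (hr : r ∈ Ico (0 : ℝ) 1) (hx : r ^ (2 ^ k) ∈ Icc (s ^ 2) (4 * s ^ 2)) {D : ℂ}
    (hD : HasSum (fun l => c l * ((r ^ (2 ^ l) * (1 - r ^ (2 ^ l)) ^ n : ℝ) : ℂ)) D) :
    s ^ 2 / 4 * a k ≤ ‖D‖ := by
  set x := r ^ (2 ^ k) with hxdef
  obtain ⟨hx0, hx1⟩ := hx
  have hss : s ^ 2 ≤ 1 / 256 := by nlinarith
  have hxpos : 0 < x := lt_of_lt_of_le (by positivity) hx0
  have hxlt : x ≤ 1 / 64 := by linarith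
  have hw : 1 / 2 ≤ (1 - x) ^ n := by
    have := one_add_mul_le_pow (a := -x) (by linarith) n
    have h3 : (n : ℝ) * x ≤ 1 / 2 := by
      have : (n : ℝ) * x ≤ n * (4 * s ^ 2) := by gcongr
      linarith
    rw [← sub_eq_add_neg] at this
    linarith
  have hak := ha k
  have hy : ∀ l, 0 ≤ r ^ (2 ^ l) ∧ r ^ (2 ^ l) ≤ 1 := fun l =>
    ⟨pow_nonneg hr.1 _, pow_le_one₀ hr.1 hr.2.le⟩
  have hm : ∀ l, 0 ≤ r ^ (2 ^ l) * (1 - r ^ (2 ^ l)) ^ n := fun l =>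
    mul_nonneg (hy l).1 (pow_nonneg (by linarith [(hy l).2]) _)
  have hnorm : ∀ l, ‖c l * ((r ^ (2 ^ l) * (1 - r ^ (2 ^ l)) ^ n : ℝ) : ℂ)‖ =
      a l * (r ^ (2 ^ l) * (1 - r ^ (2 ^ l)) ^ n) := fun l => by
    rw [norm_mul, hc, Complex.norm_real, Real.norm_of_nonneg (hm l)]
  set θ : ℝ := ((1 + s) ^ n)⁻¹ with hθ
  have hθ0 : 0 < θ := by positivity
  have hθ1 : θ ≤ s ^ 2 / 8 := by
    rw [hθ, inv_le_comm₀ (by positivity) (by positivity), inv_div, div_le_iff₀ (by positivity)]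
    linarith
  have hlow : ‖∑ l ∈ Finset.range k, c l * ((r ^ (2 ^ l) * (1 - r ^ (2 ^ l)) ^ n : ℝ) : ℂ)‖ ≤
      a k * (1 - x) ^ n * (x / 4) := by
    calc _ ≤ ∑ l ∈ Finset.range k, a k * (1 - x) ^ n * θ ^ (k - 1 - l + 1) := by
          refine norm_sum_le_of_le _ fun l hl => ?_
          have hl' := Finset.mem_range.1 hl
          obtain ⟨j, rfl⟩ := Nat.exists_eq_add_of_lt hl'
          rw [hnorm]
          have hyx : (r ^ (2 ^ l)) ^ (2 ^ (j + 1)) = x := by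
            rw [hxdef, ← pow_mul, ← pow_add]; congr 1
          have h1 := one_sub_mul_pow_le hs.le (hy l).1 (hy l).2 (j + 1) (by rw [hyx]; exact hx0)
          rw [hyx] at h1
          have h2 : (1 - r ^ (2 ^ l)) ^ n ≤ (1 - x) ^ n * θ ^ (j + 1) := by
            have h3 := pow_le_pow_left₀
              (mul_nonneg (by linarith [(hy l).2] : 0 ≤ 1 - r ^ (2 ^ l)) (by positivity)) h1 n
            rw [mul_pow, ← pow_mul, mul_comm (j + 1), pow_mul] at h3
            rw [hθ, inv_pow, ← div_eq_mul_inv, le_div_iff₀ (by positivity)]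
            exact h3
          have e : l + j + 1 - 1 - l + 1 = j + 1 := by omega
          rw [e, mul_assoc]
          refine mul_le_mul (hmono hl'.le) ?_ (hm l) hak
          refine le_trans ?_ h2
          exact mul_le_of_le_one_left (pow_nonneg (by linarith [(hy l).2]) _) (hy l).2
      _ = a k * (1 - x) ^ n * (θ * ∑ j ∈ Finset.range k, θ ^ j) := by
          rw [← Finset.mul_sum, Finset.sum_range_reflect (fun j => θ ^ (j + 1)), Finset.mul_sum]
          simp_rw [pow_succ', Finset.mul_sum]
      _ ≤ _ := by
          have h1 : ∑ j ∈ Finset.range k, θ ^ j ≤ 2 := by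
            have := mul_neg_geom_sum θ k
            have h2 : 0 ≤ ∑ j ∈ Finset.range k, θ ^ j :=
              Finset.sum_nonneg fun i _ => by positivity
            have h3 : 0 < θ ^ k := by positivity
            nlinarith
          have h2 : θ * ∑ j ∈ Finset.range k, θ ^ j ≤ x / 4 := by nlinarith
          exact mul_le_mul_of_nonneg_left h2 (by positivity)
  have htail := (hasSum_nat_add_iff' (k + 1)).2 hD
  have hup : ‖D - ∑ l ∈ Finset.range (k + 1),
      c l * ((r ^ (2 ^ l) * (1 - r ^ (2 ^ l)) ^ n : ℝ) : ℂ)‖ ≤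
      a k * x * (2 * x * (1 - 2 * x)⁻¹) := by
    rw [← htail.tsum_eq]
    refine tsum_of_norm_bounded (((hasSum_geometric_of_lt_one (by positivity : 0 ≤ 2 * x)
      (by linarith)).mul_left (2 * x)).mul_left (a k * x)) fun j => ?_
    rw [hnorm]
    have h1 := hk.le (j + 1)
    have h2 : r ^ (2 ^ (j + (k + 1))) * (1 - r ^ (2 ^ (j + (k + 1)))) ^ n ≤ x ^ (j + 2) := by
      refine (mul_le_of_le_one_right (hy _).1 (pow_le_one₀ (by linarith [(hy (j + (k + 1))).2])
        (by linarith [(hy (j + (k + 1))).1]))).trans ?_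
      have : r ^ (2 ^ (j + (k + 1))) = x ^ (2 ^ (j + 1)) := by
        rw [hxdef, ← pow_mul, ← pow_add]; congr 2; ring
      rw [this]
      exact pow_le_pow_of_le_one hxpos.le (by linarith) (Nat.lt_two_pow_self (n := j + 1))
    rw [show j + (k + 1) = k + (j + 1) by ring] at h2 ⊢
    calc _ ≤ 2 ^ (j + 1) * a k * x ^ (j + 2) :=
          mul_le_mul h1 h2 (hm _) (by positivity)
      _ = _ := by ring
  have hinv : 2 * x * (1 - 2 * x)⁻¹ ≤ (1 - x) ^ n / 4 := by
    have : 2 * x * (1 - 2 * x)⁻¹ ≤ 1 / 8 := by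
      rw [← div_eq_mul_inv, div_le_iff₀ (by linarith)]; linarith
    linarith
  have hmain : ‖c k * ((x * (1 - x) ^ n : ℝ) : ℂ)‖ = a k * (x * (1 - x) ^ n) := hnorm k
  rw [Finset.sum_range_succ] at hup
  set S := ∑ l ∈ Finset.range k, c l * ((r ^ (2 ^ l) * (1 - r ^ (2 ^ l)) ^ n : ℝ) : ℂ)
  have htri : ‖c k * ((x * (1 - x) ^ n : ℝ) : ℂ)‖ ≤ ‖D‖ + ‖S‖ +
      ‖D - (S + c k * ((x * (1 - x) ^ n : ℝ) : ℂ))‖ := by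
    calc _ = ‖D - S - (D - (S + c k * ((x * (1 - x) ^ n : ℝ) : ℂ)))‖ := by congr 1; ring
      _ ≤ _ := (norm_sub_le _ _).trans (by gcongr; exact norm_sub_le _ _)
  have h9 : a k * x * (2 * x * (1 - 2 * x)⁻¹) ≤ a k * x * ((1 - x) ^ n / 4) :=
    mul_le_mul_of_nonneg_left hinv (by positivity)
  have h10 : a k * (s ^ 2 * (1 / 2)) ≤ a k * (x * (1 - x) ^ n) := by gcongr
  rw [hmain] at htri
  linarith

/-- At a dominant index `k` the coefficient is controlled by finitely many values of the series
at points `r` with `r^{2^k}` in a fixed interval. -/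
lemma exists_dominant_rpow_le {q : ℝ} (hq : 1 ≤ q) :
    ∃ (x₀ x₁ B : ℝ) (n : ℕ), 0 < x₀ ∧ x₀ < x₁ ∧ x₁ ≤ 1 / 2 ∧ x₁ ^ 2 < x₀ ∧ 0 ≤ B ∧
      ∀ (a : ℕ → ℝ) (c : ℕ → ℂ) (g : ℝ → ℂ), (∀ k, 0 ≤ a k) → Monotone a → (∀ k, ‖c k‖ = a k) →
        (∀ r ∈ Ico (0 : ℝ) 1, HasSum (fun l => c l * (r : ℂ) ^ (2 ^ l)) (g r)) →
        ∀ k, IsDominant a k → ∀ r ∈ Ico (0 : ℝ) 1, r ^ (2 ^ k) ∈ Ico x₀ x₁ →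
          a k ^ q ≤ B * ∑ i ∈ Finset.range n, ‖g (r ^ (i + 1))‖ ^ q := by
  obtain ⟨s, n, hs, hs1, hn1, hn2⟩ : ∃ (s : ℝ) (n : ℕ), 0 < s ∧ s ≤ 1 / 16 ∧
      8 ≤ s ^ 2 * (1 + s) ^ n ∧ 8 * n * s ^ 2 ≤ 1 := by
    -- Bernoulli gives (1 + 1/256)^256 ≥ 2, hence (1+s)^n ≥ 2^32, while 8ns^2 is exactly 1.
    refine ⟨1 / 256, 256 * 32, by norm_num, by norm_num, ?_, by norm_num⟩
    have h := one_add_mul_le_pow (a := (1 / 256 : ℝ)) (by norm_num) 256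
    have h2 : (2 : ℝ) ≤ (1 + 1 / 256) ^ 256 := le_trans (by norm_num) h
    have h3 := pow_le_pow_left₀ (by norm_num) h2 32
    rw [← pow_mul] at h3
    have h4 : (8 : ℝ) ≤ (1 / 256) ^ 2 * 2 ^ 32 := by norm_num
    exact h4.trans (mul_le_mul_of_nonneg_left h3 (by norm_num))
  have hss : s ^ 2 ≤ 1 / 256 := by nlinarith
  have hs2 : 0 < s ^ 2 := by positivity
  -- The constant combines C(n,i) ≤ 2^n with the power mean inequality for n + 1 terms.
  refine ⟨s ^ 2, 4 * s ^ 2, (4 / s ^ 2 * 2 ^ n) ^ q * ((n + 1 : ℕ) : ℝ) ^ (q - 1), n + 1, hs2,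
    by linarith, by linarith, by nlinarith, by positivity, ?_⟩
  intro a c g ha hmono hc hg k hk r hr hx
  have h1 := hk.le_norm_difference ha hmono hc hs hs1 hn1 hn2 hr ⟨hx.1, hx.2.le⟩
    (hasSum_binomial_difference hg hr n)
  have h2 : ‖∑ i ∈ Finset.range (n + 1), (-1 : ℂ) ^ i * (n.choose i) * g (r ^ (i + 1))‖ ≤
      2 ^ n * ∑ i ∈ Finset.range (n + 1), ‖g (r ^ (i + 1))‖ := by
    rw [Finset.mul_sum]
    refine norm_sum_le_of_le _ fun i _ => ?_
    rw [norm_mul, norm_mul, norm_pow, norm_neg, norm_one, one_pow, one_mul, Complex.norm_natCast]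
    gcongr
    exact_mod_cast Nat.choose_le_two_pow n i
  have h3 : a k ≤ 4 / s ^ 2 * 2 ^ n * ∑ i ∈ Finset.range (n + 1), ‖g (r ^ (i + 1))‖ := by
    have := mul_le_mul_of_nonneg_left (h1.trans h2) (by positivity : 0 ≤ 4 / s ^ 2)
    calc a k = 4 / s ^ 2 * (s ^ 2 / 4 * a k) := by field_simp
      _ ≤ _ := this
      _ = _ := by ring
  have h4 := Real.rpow_le_rpow (ha k) h3 (by linarith : 0 ≤ q)
  rw [Real.mul_rpow (by positivity) (Finset.sum_nonneg fun i _ => norm_nonneg _)] at h4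
  refine h4.trans ?_
  rw [mul_assoc]
  refine mul_le_mul_of_nonneg_left ?_ (by positivity)
  have := Real.rpow_sum_le_const_mul_sum_rpow_of_nonneg (Finset.range (n + 1)) hq
    (f := fun i => ‖g (r ^ (i + 1))‖) fun i _ => norm_nonneg _
  rwa [Finset.card_range] at this

/-- Dominant indices carry a fixed proportion of a dyadic sum. -/
lemma dyadicSum_le_two_mul_dominant {q : ℝ} (hq : 1 ≤ q) {a : ℕ → ℝ} (ha : ∀ k, 0 ≤ a k)
    (hs : Summable fun k => dy k * a k) :
    dyadicSum q a ≤ 2 * ∑' k, {k | IsDominant a k}.indicator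
      (fun k => ENNReal.ofReal (dy k ^ (q - 1) * a k ^ q)) k := by
  set G := {k | IsDominant a k}.indicator fun k => ENNReal.ofReal (dy k ^ (q - 1) * a k ^ q)
  -- Since 2^{-i} a_i tends to 0, it attains its maximum over i ≥ k, and a maximizer is dominant.
  have hex : ∀ k, 0 < dy k * a k → ∃ j, IsDominant a (k + j) ∧
      dy k * a k ≤ dy (k + j) * a (k + j) := by
    intro k hk
    obtain ⟨N, hN⟩ := Filter.eventually_atTop.1 (hs.tendsto_atTop_zero.eventually_lt_const hk)
    obtain ⟨j, -, hj⟩ := Finset.exists_max_image (Finset.range (N + 1))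
      (fun j => dy (k + j) * a (k + j)) ⟨0, by simp⟩
    have h0 := hj 0 (by simp)
    refine ⟨j, fun i => ?_, h0⟩
    rw [add_assoc]
    by_cases hi : j + i < N + 1
    · exact hj _ (Finset.mem_range.2 hi)
    · exact (hN _ (by omega)).le.trans h0
  -- The k-th term is (2^{-k} a_k)^q / 2^{-k}; charging it to the dominant index k + j gains the
  -- factor 2^{-j}.
  calc dyadicSum q a ≤ ∑' k, ∑' j, ENNReal.ofReal (1 / 2) ^ j * G (k + j) := by
        refine ENNReal.tsum_le_tsum fun k => ?_
        rcases (mul_nonneg (dy_pos k).le (ha k)).eq_or_lt with h | h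
        · have : a k = 0 := by
            rcases mul_eq_zero.1 h.symm with h' | h'
            · exact absurd h' (dy_pos k).ne'
            · exact h'
          rw [this, Real.zero_rpow (by linarith)]
          simp
        · obtain ⟨j, hj, hle⟩ := hex k h
          refine le_trans ?_ (ENNReal.le_tsum j)
          simp only [G]
          rw [indicator_of_mem (show k + j ∈ {k | IsDominant a k} from hj),
            ← ENNReal.ofReal_pow (by norm_num), ← ENNReal.ofReal_mul (by positivity)]
          refine ENNReal.ofReal_le_ofReal ?_
          have h1 := Real.rpow_le_rpow h.le hle (by linarith : 0 ≤ q)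
          have hk := dy_pos k
          have hkj := dy_pos (k + j)
          rw [Real.mul_rpow hk.le (ha k), Real.mul_rpow hkj.le (ha _)] at h1
          rw [rpow_sub_one_eq hk, rpow_sub_one_eq hkj, ← dy_eq_pow]
          calc _ = (dy k ^ q * a k ^ q) / dy k := by ring
            _ ≤ (dy (k + j) ^ q * a (k + j) ^ q) / dy k := by gcongr
            _ = _ := by
              rw [dy_add]
              have := dy_pos j
              field_simp
    _ = ∑' j, ENNReal.ofReal (1 / 2) ^ j * ∑' k, G (k + j) := by
        rw [ENNReal.tsum_comm]
        simp_rw [ENNReal.tsum_mul_left]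
    _ ≤ ∑' j, ENNReal.ofReal (1 / 2) ^ j * ∑' k, G k :=
        ENNReal.tsum_le_tsum fun j => mul_le_mul' le_rfl
          (ENNReal.tsum_comp_le_tsum_of_injective (add_left_injective j) G)
    _ = _ := by
        rw [ENNReal.tsum_mul_right, ENNReal.tsum_geometric]
        congr 1
        rw [← ENNReal.ofReal_one, ← ENNReal.ofReal_sub _ (by norm_num),
          ← ENNReal.ofReal_inv_of_pos (by norm_num)]
        norm_num

/-! ### Integration over the windows r^{2^k} ∈ [x₀, x₁), and divergence on a radius. -/

/-- The points `r ∈ [0, 1)` with `r^{2^k} ∈ [x₀, x₁)`. -/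
def rootIco (x₀ x₁ : ℝ) (k : ℕ) : Set ℝ := {r | r ∈ Ico (0 : ℝ) 1 ∧ r ^ (2 ^ k) ∈ Ico x₀ x₁}

lemma measurableSet_rootIco (x₀ x₁ : ℝ) (k : ℕ) : MeasurableSet (rootIco x₀ x₁ k) :=
  measurableSet_Ico.inter (measurableSet_Ico.preimage (by fun_prop))

/-- Raising k by one squares r^{2^k}, which pushes it from [x₀, x₁) below x₀. -/
lemma pairwise_disjoint_rootIco {x₀ x₁ : ℝ} (h : x₁ ^ 2 < x₀) :
    Pairwise (Function.onFun Disjoint (rootIco x₀ x₁)) := by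
  rw [pairwise_disjoint_on]
  intro k l hkl
  rw [Set.disjoint_left]
  rintro r ⟨hr, hk⟩ ⟨-, hl⟩
  have h0 : 0 ≤ r ^ (2 ^ k) := pow_nonneg hr.1 _
  have h1 : r ^ (2 ^ l) ≤ r ^ (2 ^ (k + 1)) :=
    pow_le_pow_of_le_one hr.1 hr.2.le (Nat.pow_le_pow_right (by norm_num) hkl)
  rw [pow_succ, pow_mul] at h1
  have := hl.1
  have := hk.2
  nlinarith

lemma rootIco_subset {x₀ x₁ : ℝ} (k : ℕ) : rootIco x₀ x₁ k ⊆ Ico x₀ 1 := fun _ hr =>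
  ⟨hr.2.1.trans (pow_le_of_le_one hr.1.1 hr.1.2.le (by positivity)), hr.1.2⟩

/-- The map r ↦ r^{2^k} stretches lengths in [0, 1] by at most 2^k. -/
lemma le_volume_rootIco {x₀ x₁ : ℝ} (h0 : 0 < x₀) (h01 : x₀ < x₁) (h1 : x₁ ≤ 1) (k : ℕ) :
    ENNReal.ofReal ((x₁ - x₀) * dy k) ≤ volume (rootIco x₀ x₁ k) := by
  have hK : (2 : ℕ) ^ k ≠ 0 := by positivity
  set r₀ := x₀ ^ (((2 ^ k : ℕ) : ℝ)⁻¹)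
  set r₁ := x₁ ^ (((2 ^ k : ℕ) : ℝ)⁻¹)
  have hr0 : r₀ ^ (2 ^ k) = x₀ := Real.rpow_inv_natCast_pow h0.le hK
  have hr1 : r₁ ^ (2 ^ k) = x₁ := Real.rpow_inv_natCast_pow (h0.trans h01).le hK
  have p0 : 0 ≤ r₀ := Real.rpow_nonneg h0.le _
  have p1 : r₁ ≤ 1 := Real.rpow_le_one (h0.trans h01).le h1 (by positivity)
  have p01 : r₀ ≤ r₁ := Real.rpow_le_rpow h0.le h01.le (by positivity)
  have hsub : Ico r₀ r₁ ⊆ rootIco x₀ x₁ k := fun r hr =>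
    ⟨⟨p0.trans hr.1, hr.2.trans_le p1⟩, hr0 ▸ pow_le_pow_left₀ p0 hr.1 _,
      hr1 ▸ pow_lt_pow_left₀ hr.2 (p0.trans hr.1) hK⟩
  refine le_trans ?_ (measure_mono hsub)
  rw [Real.volume_Ico]
  refine ENNReal.ofReal_le_ofReal ?_
  have hsum := (Commute.all r₁ r₀).geom_sum₂_mul (2 ^ k)
  have hle : ∑ i ∈ Finset.range (2 ^ k), r₁ ^ i * r₀ ^ (2 ^ k - 1 - i) ≤ 2 ^ k := by
    calc _ ≤ ∑ i ∈ Finset.range (2 ^ k), (1 : ℝ) :=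
          Finset.sum_le_sum fun i _ => mul_le_one₀ (pow_le_one₀ (p0.trans p01) p1) (by positivity)
            (pow_le_one₀ p0 (p01.trans p1))
      _ = _ := by simp
  rw [hr0, hr1] at hsum
  rw [← hsum]
  have hd := dy_pos k
  calc _ ≤ 2 ^ k * (r₁ - r₀) * dy k := by
        have : 0 ≤ r₁ - r₀ := by linarith
        gcongr
    _ = (dy k * 2 ^ k) * (r₁ - r₀) := by ring
    _ = _ := by rw [dy_mul_two_pow, one_mul]

/-- On the k-th window 1 - r is comparable to 2^{-k}: Bernoulli gives the lower bound,
`pow_pred_mul_le` the upper one. -/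
lemma one_sub_mem_of_mem_rootIco {x₀ x₁ : ℝ} (h0 : 0 < x₀) (h1 : x₁ ≤ 1 / 2) {k : ℕ} {r : ℝ}
    (hr : r ∈ rootIco x₀ x₁ k) : dy k / 2 ≤ 1 - r ∧ 1 - r ≤ dy k / x₀ := by
  have hd := dy_pos k
  have hK := dy_mul_two_pow k
  constructor
  · have hb := one_add_mul_le_pow (a := r - 1) (by linarith [hr.1.1]) (2 ^ k)
    rw [add_sub_cancel] at hb
    push_cast at hb
    have h2 := hr.2.2
    have h3 : 1 / 2 ≤ 2 ^ k * (1 - r) := by linarith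
    have h4 := mul_le_mul_of_nonneg_left h3 hd.le
    rw [← mul_assoc, hK] at h4
    linarith
  · have hb := pow_pred_mul_le hr.1.1 hr.1.2 (N := 2 ^ k)
    push_cast at hb
    have h2 : x₀ ≤ r ^ (2 ^ k - 1) :=
      hr.2.1.trans (pow_le_pow_of_le_one hr.1.1 hr.1.2.le (Nat.sub_le _ _))
    have h3 : 0 ≤ 2 ^ k * (1 - r) := mul_nonneg (by positivity) (by linarith [hr.1.2])
    have h4 := (mul_le_mul_of_nonneg_left h2 h3).trans hb
    have h5 := mul_le_mul_of_nonneg_left h4 hd.le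
    rw [le_div_iff₀ h0]
    calc (1 - r) * x₀ = dy k * 2 ^ k * ((1 - r) * x₀) := by rw [hK, one_mul]
      _ = dy k * (2 ^ k * (1 - r) * x₀) := by ring
      _ ≤ _ := by linarith

lemma exists_le_lintegral_rootIco {q x₀ x₁ : ℝ} (hq : 0 ≤ q) (h0 : 0 < x₀) (h01 : x₀ < x₁)
    (h1 : x₁ ≤ 1 / 2) :
    ∃ c : ℝ, 0 < c ∧ ∀ k, ENNReal.ofReal (c * dy k ^ (q - 1)) ≤
      ∫⁻ r in rootIco x₀ x₁ k, ENNReal.ofReal ((1 - r) ^ (q - 2)) := by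
  have h01' : 0 < x₁ - x₀ := by linarith
  refine ⟨(1 / 2) ^ q * x₀ ^ 2 * (x₁ - x₀), by positivity, fun k => ?_⟩
  have hd := dy_pos k
  calc _ = ENNReal.ofReal ((dy k / 2) ^ q / (dy k / x₀) ^ 2) *
        ENNReal.ofReal ((x₁ - x₀) * dy k) := by
        rw [← ENNReal.ofReal_mul (by positivity), rpow_sub_one_eq hd, div_eq_mul_one_div (dy k) 2,
          Real.mul_rpow hd.le (by norm_num)]
        congr 1
        field_simp
    _ ≤ ENNReal.ofReal ((dy k / 2) ^ q / (dy k / x₀) ^ 2) * volume (rootIco x₀ x₁ k) :=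
        mul_le_mul' le_rfl (le_volume_rootIco h0 h01 (by linarith) k)
    _ = ∫⁻ r in rootIco x₀ x₁ k, ENNReal.ofReal ((dy k / 2) ^ q / (dy k / x₀) ^ 2) := by
        rw [setLIntegral_const]
    _ ≤ _ := by
        refine setLIntegral_mono' (measurableSet_rootIco _ _ _) fun r hr =>
          ENNReal.ofReal_le_ofReal ?_
        have h := one_sub_mem_of_mem_rootIco h0 h1 hr
        exact le_rpow_sub_two (by positivity) h.1 h.2 hq

/-- Dilations `r ↦ r^m` preserve the weighted radial integrals up to a constant. -/
lemma lintegral_comp_pow_le {q x₀ : ℝ} (hq : 0 ≤ q) (h0 : 0 < x₀) (m : ℕ) (hm : m ≠ 0)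
    (H : ℝ → ENNReal) :
    ∫⁻ r in Ico x₀ 1, ENNReal.ofReal ((1 - r) ^ (q - 2)) * H (r ^ m) ≤
      ENNReal.ofReal (m / x₀ ^ (m - 1)) *
        ∫⁻ r in Ico (0 : ℝ) 1, ENNReal.ofReal ((1 - r) ^ (q - 2)) * H r := by
  have hinj : InjOn (fun r : ℝ => r ^ m) (Ico x₀ 1) := fun x hx y hy h =>
    (pow_left_inj₀ (h0.le.trans hx.1) (h0.le.trans hy.1) hm).1 h
  have himg : (fun r : ℝ => r ^ m) '' Ico x₀ 1 ⊆ Ico 0 1 := by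
    rintro _ ⟨r, hr, rfl⟩
    exact ⟨pow_nonneg (h0.le.trans hr.1) _, pow_lt_one₀ (h0.le.trans hr.1) hr.2 hm⟩
  have hm0 : (0 : ℝ) < m := by positivity
  -- From 1 - r ≤ 1 - r^m ≤ m(1 - r) the weight costs m^2; inserting the Jacobian costs 1/(m
  -- x₀^{m-1}), which is why r stays above x₀.
  calc _ ≤ ∫⁻ r in Ico x₀ 1, ENNReal.ofReal (m / x₀ ^ (m - 1)) *
        (ENNReal.ofReal |m * r ^ (m - 1)| *
          (ENNReal.ofReal ((1 - r ^ m) ^ (q - 2)) * H (r ^ m))) := by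
        refine setLIntegral_mono' measurableSet_Ico fun r hr => ?_
        have hr0 : 0 < r := h0.trans_le hr.1
        have hr1 : 0 < 1 - r := by linarith [hr.2]
        rw [abs_of_nonneg (by positivity), ← mul_assoc, ← mul_assoc, mul_assoc (ENNReal.ofReal _),
          ← ENNReal.ofReal_mul (by positivity), ← ENNReal.ofReal_mul (by positivity)]
        refine mul_le_mul' (ENNReal.ofReal_le_ofReal ?_) le_rfl
        have hle : 1 - r ≤ 1 - r ^ m := by
          have := pow_le_of_le_one hr0.le hr.2.le hm
          linarith
        have hlem : 1 - r ^ m ≤ m * (1 - r) := by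
          have := one_add_mul_le_pow (a := r - 1) (by linarith) m
          rw [add_sub_cancel] at this
          linarith
        have hmpos : 0 < 1 - r ^ m := hr1.trans_le hle
        have h2 : (1 - r) ^ (q - 2) ≤ m ^ 2 * (1 - r ^ m) ^ (q - 2) := by
          rw [rpow_sub_two_eq hr1, rpow_sub_two_eq hmpos, div_le_iff₀ (by positivity)]
          have h3 := Real.rpow_le_rpow hr1.le hle hq
          have h4 : (1 - r ^ m) ^ 2 ≤ m ^ 2 * (1 - r) ^ 2 := by
            rw [← mul_pow]; exact pow_le_pow_left₀ hmpos.le hlem 2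
          calc _ ≤ (1 - r ^ m) ^ q * 1 := by rw [mul_one]; exact h3
            _ ≤ (1 - r ^ m) ^ q * (m ^ 2 * (1 - r) ^ 2 / (1 - r ^ m) ^ 2) := by
                refine mul_le_mul_of_nonneg_left ?_ (Real.rpow_nonneg hmpos.le _)
                rw [le_div_iff₀ (by positivity), one_mul]; exact h4
            _ = _ := by ring
        rw [← mul_assoc (_ / _)]
        refine h2.trans (mul_le_mul_of_nonneg_right ?_ (Real.rpow_nonneg hmpos.le _))
        have h5 : x₀ ^ (m - 1) ≤ r ^ (m - 1) := pow_le_pow_left₀ h0.le hr.1 _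
        rw [div_mul_eq_mul_div, le_div_iff₀ (by positivity)]
        calc _ ≤ (m : ℝ) ^ 2 * r ^ (m - 1) := by gcongr
          _ = _ := by ring
    _ = ENNReal.ofReal (m / x₀ ^ (m - 1)) * ∫⁻ r in (fun r : ℝ => r ^ m) '' Ico x₀ 1,
        ENNReal.ofReal ((1 - r) ^ (q - 2)) * H r := by
        rw [lintegral_const_mul' _ _ ENNReal.ofReal_ne_top,
          lintegral_image_eq_lintegral_abs_deriv_mul measurableSet_Ico
            (fun r _ => (hasDerivAt_pow m r).hasDerivWithinAt) hinj]
    _ ≤ _ := mul_le_mul' le_rfl (lintegral_mono_set himg)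

/-- A lacunary series with nondecreasing coefficient moduli has divergent weighted radial integral
as soon as the dyadic sum of its coefficients diverges. -/
lemma radialIntegral_lacunary_eq_top {q : ℝ} (hq : 1 ≤ q) {a : ℕ → ℝ} {c : ℕ → ℂ} {g : ℝ → ℂ}
    (ha : ∀ k, 0 ≤ a k) (hmono : Monotone a) (hc : ∀ k, ‖c k‖ = a k)
    (hs : Summable fun k => dy k * a k)
    (hg : ∀ r ∈ Ico (0 : ℝ) 1, HasSum (fun l => c l * (r : ℂ) ^ (2 ^ l)) (g r))
    (hcont : ContinuousOn g (Ico 0 1)) (htop : dyadicSum q a = ⊤) :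
    radialIntegral q (fun r => ‖g r‖) = ⊤ := by
  have hq0 : 0 ≤ q := by linarith
  obtain ⟨x₀, x₁, B, n, h0, h01, h1, hdisj, hB, hdom⟩ := exists_dominant_rpow_le hq
  obtain ⟨b, hb, hI⟩ := exists_le_lintegral_rootIco hq0 h0 h01 h1
  set H : ℝ → ENNReal := fun r => ENNReal.ofReal (‖g r‖ ^ q) with hH
  set w : ℝ → ENNReal := fun r => ENNReal.ofReal ((1 - r) ^ (q - 2)) with hw
  have hwm : Measurable w := by fun_prop
  have hrad : radialIntegral q (fun r => ‖g r‖) = ∫⁻ r in Ico (0 : ℝ) 1, w r * H r :=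
    setLIntegral_congr_fun measurableSet_Ico fun r hr =>
      ENNReal.ofReal_mul (Real.rpow_nonneg (by linarith [hr.2]) _)
  set G := {k | IsDominant a k}.indicator fun k => ENNReal.ofReal (dy k ^ (q - 1) * a k ^ q)
  have hG : ∑' k, G k = ⊤ := by
    by_contra h
    refine absurd (dyadicSum_le_two_mul_dominant hq ha hs) (not_le.2 ?_)
    rw [htop]
    exact ENNReal.mul_lt_top (by simp) (lt_top_iff_ne_top.2 h)
  have hGk : ∀ k, ENNReal.ofReal b * G k ≤ ∫⁻ r in rootIco x₀ x₁ k,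
      ENNReal.ofReal B * ∑ i ∈ Finset.range n, w r * H (r ^ (i + 1)) := fun k => by
    by_cases hk : IsDominant a k
    · simp only [G]
      rw [indicator_of_mem (show k ∈ {k | IsDominant a k} from hk), ← ENNReal.ofReal_mul hb.le,
        ← mul_assoc, ENNReal.ofReal_mul' (Real.rpow_nonneg (ha k) q)]
      refine (mul_le_mul' (hI k) le_rfl).trans ?_
      rw [← lintegral_mul_const' _ _ ENNReal.ofReal_ne_top]
      refine setLIntegral_mono' (measurableSet_rootIco _ _ _) fun r hr => ?_
      have := ENNReal.ofReal_le_ofReal (hdom a c g ha hmono hc hg k hk r hr.1 hr.2)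
      rw [ENNReal.ofReal_mul hB, ENNReal.ofReal_sum_of_nonneg fun i _ => by positivity] at this
      refine (mul_le_mul' le_rfl this).trans (le_of_eq ?_)
      rw [← Finset.mul_sum]
      ring
    · simp only [G]
      rw [indicator_of_notMem (show k ∉ {k | IsDominant a k} from hk), mul_zero]
      exact zero_le
  have hmeas : ∀ i, AEMeasurable (fun r => w r * H (r ^ (i + 1))) (volume.restrict (Ico x₀ 1)) :=
    fun i => by
      refine hwm.aemeasurable.mul (ENNReal.measurable_ofReal.comp_aemeasurable ?_)
      refine ContinuousOn.aemeasurable ?_ measurableSet_Ico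
      refine ContinuousOn.rpow_const ?_ fun _ _ => Or.inr hq0
      refine (hcont.comp (by fun_prop) fun r hr => ?_).norm
      exact ⟨pow_nonneg (h0.le.trans hr.1) _, pow_lt_one₀ (h0.le.trans hr.1) hr.2 (by omega)⟩
  -- Every dilate is bounded by a finite multiple of the same radial integral, which therefore
  -- cannot be finite.
  have hmain : ⊤ ≤ ENNReal.ofReal B * ∑ i ∈ Finset.range n,
      ENNReal.ofReal ((i + 1 : ℕ) / x₀ ^ (i + 1 - 1)) * ∫⁻ r in Ico (0 : ℝ) 1, w r * H r := by
    calc ⊤ = ∑' k, ENNReal.ofReal b * G k := by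
          rw [ENNReal.tsum_mul_left, hG, ENNReal.mul_top (by simpa using hb)]
      _ ≤ ∑' k, ∫⁻ r in rootIco x₀ x₁ k,
          ENNReal.ofReal B * ∑ i ∈ Finset.range n, w r * H (r ^ (i + 1)) :=
          ENNReal.tsum_le_tsum hGk
      _ = ∫⁻ r in ⋃ k, rootIco x₀ x₁ k,
          ENNReal.ofReal B * ∑ i ∈ Finset.range n, w r * H (r ^ (i + 1)) :=
          (lintegral_iUnion (measurableSet_rootIco _ _) (pairwise_disjoint_rootIco hdisj) _).symm
      _ ≤ ∫⁻ r in Ico x₀ 1,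
          ENNReal.ofReal B * ∑ i ∈ Finset.range n, w r * H (r ^ (i + 1)) :=
          lintegral_mono_set (iUnion_subset fun k => rootIco_subset k)
      _ = ENNReal.ofReal B * ∑ i ∈ Finset.range n, ∫⁻ r in Ico x₀ 1, w r * H (r ^ (i + 1)) := by
          rw [lintegral_const_mul' _ _ ENNReal.ofReal_ne_top,
            lintegral_finsetSum' _ fun i _ => hmeas i]
      _ ≤ _ := mul_le_mul' le_rfl (Finset.sum_le_sum fun i _ =>
          lintegral_comp_pow_le hq0 h0 (i + 1) (by omega) H)
  rw [hrad]
  by_contra h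
  refine absurd hmain (not_le.2 ?_)
  refine ENNReal.mul_lt_top (by simp) (ENNReal.sum_lt_top.2 fun i _ => ?_)
  exact ENNReal.mul_lt_top (by simp) (lt_top_iff_ne_top.2 h)

/-! ### From radial integrals to area integrals. -/

lemma lintegral_discArea {H : ℂ → ENNReal} (hH : Measurable H) :
    ∫⁻ z, H z ∂discArea = ENNReal.ofReal Real.pi⁻¹ *
      ∫⁻ θ in Ioo (-Real.pi) Real.pi, ∫⁻ r in Ioo (0 : ℝ) 1,
        ENNReal.ofReal r * H (circleMap 0 r θ) := by
  rw [discArea, lintegral_smul_measure, smul_eq_mul]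
  congr 1
  have hcirc : Measurable fun x : ℝ × ℝ => circleMap 0 x.1 x.2 := by
    unfold circleMap; fun_prop
  have hsymm : ∀ x : ℝ × ℝ, Complex.polarCoord.symm x = circleMap 0 x.1 x.2 := fun x => by
    rw [Complex.polarCoord_symm_apply, circleMap, zero_add, Complex.exp_mul_I,
      Complex.ofReal_cos, Complex.ofReal_sin]
  rw [← lintegral_indicator measurableSet_ball, ← Complex.lintegral_comp_polarCoord_symm,
    polarCoord_target, Measure.volume_eq_prod, ← Measure.prod_restrict, lintegral_prod_symm]
  · refine lintegral_congr fun θ => ?_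
    rw [← lintegral_indicator measurableSet_Ioi, ← lintegral_indicator measurableSet_Ioo]
    refine lintegral_congr fun r => ?_
    simp only [indicator, mem_Ioi, mem_Ioo, mem_ball_zero_iff, hsymm, norm_circleMap_zero,
      smul_eq_mul]
    by_cases h0 : 0 < r
    · by_cases h1 : r < 1 <;> simp [h0, h1, abs_of_pos]
    · simp [h0]
  · refine Measurable.aemeasurable ?_
    simp only [hsymm, smul_eq_mul]
    exact (by fun_prop : Measurable fun x : ℝ × ℝ => ENNReal.ofReal x.1).mul
      ((hH.indicator measurableSet_ball).comp hcirc)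

lemma measurable_bergman_integrand {g : ℂ → ℂ} (hg : Measurable g) (s : ℝ) :
    Measurable fun z : ℂ => ENNReal.ofReal ((1 - ‖z‖ ^ 2) ^ (s - 2) * ‖g z‖ ^ s) := by
  fun_prop

/-- Uniformly bounded radial integrals force the area integral to be finite. -/
lemma lintegral_discArea_lt_top {s : ℝ} (hs : 0 ≤ s) {g : ℂ → ℂ} (hg : Measurable g)
    {C : ENNReal} (hC : C ≠ ⊤)
    (h : ∀ θ : ℝ, radialIntegral s (fun r => ‖g (circleMap 0 r θ)‖) ≤ C) :
    ∫⁻ z, ENNReal.ofReal ((1 - ‖z‖ ^ 2) ^ (s - 2) * ‖g z‖ ^ s) ∂discArea < ⊤ := by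
  rw [lintegral_discArea (measurable_bergman_integrand hg s)]
  refine ENNReal.mul_lt_top (by simp) ?_
  have hin : ∀ θ : ℝ, ∫⁻ r in Ioo (0 : ℝ) 1, ENNReal.ofReal r *
      ENNReal.ofReal ((1 - ‖circleMap 0 r θ‖ ^ 2) ^ (s - 2) * ‖g (circleMap 0 r θ)‖ ^ s) ≤
      ENNReal.ofReal (2 ^ s) * C := fun θ => by
    refine le_trans ?_ (mul_le_mul' le_rfl (h θ))
    unfold radialIntegral
    rw [← lintegral_const_mul' _ _ ENNReal.ofReal_ne_top]
    refine le_trans (setLIntegral_mono' measurableSet_Ioo fun r hr => ?_)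
      (lintegral_mono_set Ioo_subset_Ico_self)
    obtain ⟨h0, h1⟩ := hr
    rw [← ENNReal.ofReal_mul h0.le, ← ENNReal.ofReal_mul (by positivity), norm_circleMap_zero,
      abs_of_pos h0]
    refine ENNReal.ofReal_le_ofReal ?_
    have h2 : (1 - r ^ 2) ^ (s - 2) ≤ 2 ^ s * (1 - r) ^ (s - 2) := by
      rw [show 1 - r ^ 2 = (1 + r) * (1 - r) by ring,
        Real.mul_rpow (by linarith) (by linarith)]
      refine mul_le_mul_of_nonneg_right ?_ (Real.rpow_nonneg (by linarith) _)
      have := rpow_sub_two_le (c := 1) (t := 1 + r) (b := 2) one_pos (by linarith) (by linarith) hs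
      simpa using this
    have h3 : 0 ≤ (1 - r ^ 2) ^ (s - 2) := Real.rpow_nonneg (by nlinarith) _
    calc _ ≤ 1 * ((1 - r ^ 2) ^ (s - 2) * ‖g (circleMap 0 r θ)‖ ^ s) := by gcongr
      _ ≤ 2 ^ s * (1 - r) ^ (s - 2) * ‖g (circleMap 0 r θ)‖ ^ s := by
          rw [one_mul]; gcongr
      _ = _ := by ring
  calc _ ≤ ∫⁻ θ in Ioo (-Real.pi) Real.pi, ENNReal.ofReal (2 ^ s) * C :=
        lintegral_mono hin
    _ < ⊤ := by
        rw [setLIntegral_const, Real.volume_Ioo]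
        exact ENNReal.mul_lt_top (ENNReal.mul_lt_top (by simp) (lt_top_iff_ne_top.2 hC)) (by simp)

/-- Divergence of all the radial integrals of `z g(z)` forces the area integral to diverge. -/
lemma lintegral_discArea_eq_top {s : ℝ} (hs : 1 ≤ s) {g : ℂ → ℂ} (hg : Measurable g)
    (h : ∀ θ : ℝ, radialIntegral s (fun r => ‖circleMap 0 r θ * g (circleMap 0 r θ)‖) = ⊤) :
    ∫⁻ z, ENNReal.ofReal ((1 - ‖z‖ ^ 2) ^ (s - 2) * ‖g z‖ ^ s) ∂discArea = ⊤ := by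
  rw [lintegral_discArea (measurable_bergman_integrand hg s)]
  have hin : ∀ θ : ℝ, ∫⁻ r in Ioo (0 : ℝ) 1, ENNReal.ofReal r *
      ENNReal.ofReal ((1 - ‖circleMap 0 r θ‖ ^ 2) ^ (s - 2) * ‖g (circleMap 0 r θ)‖ ^ s) = ⊤ := by
    intro θ
    have hle : ENNReal.ofReal (1 / 4) * radialIntegral s
        (fun r => ‖circleMap 0 r θ * g (circleMap 0 r θ)‖) ≤ ∫⁻ r in Ioo (0 : ℝ) 1,
        ENNReal.ofReal r * ENNReal.ofReal
          ((1 - ‖circleMap 0 r θ‖ ^ 2) ^ (s - 2) * ‖g (circleMap 0 r θ)‖ ^ s) := by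
      unfold radialIntegral
      rw [← lintegral_const_mul' _ _ ENNReal.ofReal_ne_top, setLIntegral_congr Ioo_ae_eq_Ico.symm]
      refine setLIntegral_mono' measurableSet_Ioo fun r hr => ?_
      obtain ⟨h0, h1⟩ := hr
      beta_reduce
      rw [← ENNReal.ofReal_mul h0.le, ← ENNReal.ofReal_mul (by norm_num), norm_mul,
        norm_circleMap_zero, abs_of_pos h0, Real.mul_rpow h0.le (norm_nonneg _)]
      refine ENNReal.ofReal_le_ofReal ?_
      have h2 : 1 / 4 * (1 - r) ^ (s - 2) ≤ (1 - r ^ 2) ^ (s - 2) := by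
        rw [show 1 - r ^ 2 = (1 + r) * (1 - r) by ring,
          Real.mul_rpow (by linarith) (by linarith)]
        refine mul_le_mul_of_nonneg_right ?_ (Real.rpow_nonneg (by linarith) _)
        have := le_rpow_sub_two (c := 1) (t := 1 + r) (b := 2) (s := s) one_pos (by linarith)
          (by linarith) (by linarith)
        rw [Real.one_rpow] at this
        linarith
      -- The factor |z|^s is absorbed by the polar Jacobian r.
      have h3 : r ^ s ≤ r := by
        simpa using Real.rpow_le_rpow_of_exponent_ge h0 h1.le hs
      have h4 : 0 ≤ (1 - r ^ 2) ^ (s - 2) := Real.rpow_nonneg (by nlinarith) _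
      calc _ = (1 / 4 * (1 - r) ^ (s - 2)) * (r ^ s * ‖g (circleMap 0 r θ)‖ ^ s) := by ring
        _ ≤ (1 - r ^ 2) ^ (s - 2) * (r * ‖g (circleMap 0 r θ)‖ ^ s) := by gcongr
        _ = _ := by ring
    rw [h θ, ENNReal.mul_top (by simp)] at hle
    exact top_le_iff.1 hle
  simp_rw [hin]
  have hpi := Real.pi_pos
  rw [setLIntegral_const, Real.volume_Ioo, ENNReal.top_mul (by simp; linarith),
    ENNReal.mul_top (by simpa using hpi)]

lemma memBesov_of_radialIntegral_le {s : ℝ} (hs : 1 < s) {f : ℂ → ℂ}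
    (hf : DifferentiableOn ℂ f (ball 0 1)) {C : ENNReal} (hC : C ≠ ⊤)
    (h : ∀ θ : ℝ, radialIntegral s (fun r => ‖deriv f (circleMap 0 r θ)‖) ≤ C) : MemBesov s f :=
  ⟨hf, hf.deriv isOpen_ball, ENNReal.mul_lt_top (by simp)
    (lintegral_discArea_lt_top (by linarith) (measurable_deriv f) hC h)⟩

lemma not_memBesov_of_radialIntegral_eq_top {s : ℝ} (hs : 1 < s) {f : ℂ → ℂ}
    (h : ∀ θ : ℝ, radialIntegral s (fun r => ‖circleMap 0 r θ * deriv f (circleMap 0 r θ)‖) = ⊤) :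
    ¬ MemBesov s f := by
  rintro ⟨-, -, hlt⟩
  rw [lintegral_discArea_eq_top hs.le (measurable_deriv f) h, ENNReal.mul_top (by simp; linarith)]
    at hlt
  exact lt_irrefl _ hlt

/-! ### Lower bound for the integral means. -/

/-- Jensen: integral means increase with the exponent, compared at exponents `1` and `p`. -/
lemma mean_norm_le_integralMean {p r : ℝ} (hp : 1 ≤ p) {F : ℂ → ℂ}
    (hF : Continuous fun θ : ℝ => F (circleMap 0 r θ)) :
    (2 * Real.pi)⁻¹ * ∫ θ in (0 : ℝ)..2 * Real.pi, ‖F (circleMap 0 r θ)‖ ≤ integralMean p r F := by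
  have hpi := Real.two_pi_pos
  have hp0 : 0 < p := by linarith
  have hvol : volume.real (Ioc (0 : ℝ) (2 * Real.pi)) = 2 * Real.pi := by
    simp [Real.volume_real_Ioc_of_le hpi.le]
  have hJ := (convexOn_rpow hp).map_set_average_le (μ := volume) (t := Ioc (0 : ℝ) (2 * Real.pi))
    (f := fun θ : ℝ => ‖F (circleMap 0 r θ)‖)
    (fun x _ => (Real.continuousAt_rpow_const x p (Or.inr hp0.le)).continuousWithinAt) isClosed_Ici
    (by simp [Real.pi_pos]) measure_Ioc_lt_top.ne (Filter.Eventually.of_forall fun θ => norm_nonneg _)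
    (hF.norm.integrableOn_Ioc)
    ((hF.norm.rpow_const fun _ => Or.inr hp0.le).integrableOn_Ioc)
  rw [setAverage_eq, setAverage_eq, hvol, ← intervalIntegral.integral_of_le hpi.le,
    ← intervalIntegral.integral_of_le hpi.le, smul_eq_mul, smul_eq_mul] at hJ
  have h0 : 0 ≤ (2 * Real.pi)⁻¹ * ∫ θ in (0 : ℝ)..2 * Real.pi, ‖F (circleMap 0 r θ)‖ :=
    mul_nonneg (by positivity) (intervalIntegral.integral_nonneg hpi.le fun _ _ => norm_nonneg _)
  rw [integralMean, one_div]
  calc _ = (((2 * Real.pi)⁻¹ * ∫ θ in (0 : ℝ)..2 * Real.pi, ‖F (circleMap 0 r θ)‖) ^ p) ^ p⁻¹ :=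
        (Real.rpow_rpow_inv h0 hp0.ne').symm
    _ ≤ _ := Real.rpow_le_rpow (Real.rpow_nonneg h0 p) hJ (by positivity)

lemma integral_circleMap_pow_mul_exp (r : ℝ) (N m : ℕ) :
    ∫ θ in (0 : ℝ)..2 * Real.pi, circleMap 0 r θ ^ N * Complex.exp (-(m * θ * Complex.I)) =
      if N = m then 2 * Real.pi * (r : ℂ) ^ m else 0 := by
  have hint : ∀ θ : ℝ, circleMap 0 r θ ^ N * Complex.exp (-(m * θ * Complex.I)) =
      (r : ℂ) ^ N * Complex.exp (((N : ℂ) - m) * Complex.I * θ) := fun θ => by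
    rw [circleMap, zero_add, mul_pow, ← Complex.exp_nat_mul, mul_assoc, ← Complex.exp_add]
    congr 2
    ring
  simp_rw [hint]
  rw [intervalIntegral.integral_const_mul]
  split_ifs with h
  · subst h
    simp [mul_comm]
  · have hne : ((N : ℂ) - m) * Complex.I ≠ 0 := by
      refine mul_ne_zero (sub_ne_zero.2 ?_) Complex.I_ne_zero
      exact_mod_cast h
    rw [integral_exp_mul_complex hne]
    have : Complex.exp (((N : ℂ) - m) * Complex.I * ((2 * Real.pi : ℝ) : ℂ)) = 1 := by
      rw [← Complex.exp_int_mul_two_pi_mul_I ((N : ℤ) - m)]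
      congr 1
      push_cast
      ring
    rw [this]
    simp

/-- Cauchy's estimate in the mean for the derivative of a gap series. -/
lemma coeff_mul_pow_le_integralMean {p : ℝ} (hp : 1 ≤ p) {a : ℕ → ℝ} (ha : ∀ k, 0 ≤ a k)
    (hs : Summable fun k => dy k * a k) {r : ℝ} (hr : r ∈ Ico (0 : ℝ) 1) (k : ℕ) :
    a k * r ^ (2 ^ k - 1) ≤ integralMean p r (deriv (gapSeries a)) := by
  have hpi := Real.two_pi_pos
  set F := deriv (gapSeries a) with hF
  have hmem : ∀ θ : ℝ, circleMap 0 r θ ∈ ball (0 : ℂ) 1 := fun θ => by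
    rw [mem_ball_zero_iff, norm_circleMap_zero, abs_of_nonneg hr.1]; exact hr.2
  have hcont : Continuous fun θ : ℝ => F (circleMap 0 r θ) :=
    (differentiableOn_deriv_gapSeries ha hs).continuousOn.comp_continuous
      (continuous_circleMap 0 r) hmem
  refine le_trans ?_ (mean_norm_le_integralMean hp hcont)
  have hsum : Summable fun l => a l * r ^ (2 ^ l - 1) := by
    have h := (hasSum_deriv_gapSeries ha hs (z := (r : ℂ)) (by
      rw [mem_ball_zero_iff, Complex.norm_real, Real.norm_of_nonneg hr.1]; exact hr.2)).summable.norm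
    refine h.congr fun l => ?_
    rw [norm_mul, norm_pow, Complex.norm_real, Complex.norm_real, Real.norm_of_nonneg (ha l),
      Real.norm_of_nonneg hr.1]
  set m := 2 ^ k - 1 with hm
  have hexp : ∀ θ : ℝ, ‖Complex.exp (-(m * θ * Complex.I))‖ = 1 := fun θ => by
    have := Complex.norm_exp_ofReal_mul_I (-(m * θ))
    rw [← this]
    congr 2
    push_cast
    ring
  have hI := intervalIntegral.hasSum_integral_of_dominated_convergence (μ := volume)
    (a := 0) (b := 2 * Real.pi)
    (F := fun l (θ : ℝ) => ((a l : ℂ) * circleMap 0 r θ ^ (2 ^ l - 1)) *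
      Complex.exp (-(m * θ * Complex.I)))
    (f := fun θ => F (circleMap 0 r θ) * Complex.exp (-(m * θ * Complex.I)))
    (fun l _ => a l * r ^ (2 ^ l - 1))
    (fun l => by
      refine Continuous.aestronglyMeasurable ?_
      have := continuous_circleMap 0 r
      fun_prop)
    (fun l => Filter.Eventually.of_forall fun θ _ => by
      rw [norm_mul, hexp, mul_one, norm_mul, norm_pow, norm_circleMap_zero, abs_of_nonneg hr.1,
        Complex.norm_real, Real.norm_of_nonneg (ha l)])
    (Filter.Eventually.of_forall fun θ _ => hsum)
    (by simp)
    (Filter.Eventually.of_forall fun θ _ => (hasSum_deriv_gapSeries ha hs (hmem θ)).mul_right _)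
  have hterm : ∀ l, ∫ θ in (0 : ℝ)..2 * Real.pi, ((a l : ℂ) * circleMap 0 r θ ^ (2 ^ l - 1)) *
      Complex.exp (-(m * θ * Complex.I)) =
      if l = k then (a k : ℂ) * (2 * Real.pi * (r : ℂ) ^ m) else 0 := fun l => by
    simp_rw [mul_assoc (a l : ℂ)]
    rw [intervalIntegral.integral_const_mul, integral_circleMap_pow_mul_exp]
    by_cases h : l = k
    · subst h; simp [hm]
    · have : 2 ^ l - 1 ≠ m := fun h' => h (Nat.pow_right_injective le_rfl (by
        have h1 := Nat.one_le_two_pow (n := l)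
        have h2 := Nat.one_le_two_pow (n := k)
        simp only
        omega))
      simp [h, this]
  simp_rw [hterm] at hI
  have heq := hI.unique (hasSum_ite_eq k _)
  have hnorm : ‖(a k : ℂ) * (2 * Real.pi * (r : ℂ) ^ m)‖ = 2 * Real.pi * (a k * r ^ m) := by
    rw [norm_mul, norm_mul, norm_mul, norm_pow, Complex.norm_real, Complex.norm_real,
      Complex.norm_real, Real.norm_of_nonneg (ha k), Real.norm_of_nonneg hr.1,
      Real.norm_of_nonneg Real.pi_pos.le, Complex.norm_ofNat]
    ring
  rw [le_inv_mul_iff₀ hpi, ← hnorm, ← heq]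
  refine (intervalIntegral.norm_integral_le_integral_norm hpi.le).trans (le_of_eq ?_)
  refine intervalIntegral.integral_congr fun θ _ => ?_
  simp only [norm_mul, hexp, mul_one]

/-! ### The estimates applied to the gap series. -/

section

variable {a : ℕ → ℝ}

/-- On the ray of argument θ the series is lacunary in r with rotated coefficients; equal moduli
make the estimates uniform in θ. Both exponents 2^k - 1 and 2^k occur as N. -/
lemma norm_coeff_twist (ha : ∀ k, 0 ≤ a k) (θ : ℝ) (N : ℕ → ℕ) (k : ℕ) :
    ‖(a k : ℂ) * Complex.exp (θ * Complex.I) ^ N k‖ = a k := by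
  rw [norm_mul, norm_pow, Complex.norm_exp_ofReal_mul_I, one_pow, mul_one, Complex.norm_real,
    Real.norm_of_nonneg (ha k)]

lemma circleMap_zero_mem_ball {r : ℝ} (hr : r ∈ Ico (0 : ℝ) 1) (θ : ℝ) :
    circleMap 0 r θ ∈ ball (0 : ℂ) 1 := by
  rw [mem_ball_zero_iff, norm_circleMap_zero, abs_of_nonneg hr.1]; exact hr.2

lemma memBesov_gapSeries {p : ℝ} (hp : 1 < p) (ha : ∀ k, 0 ≤ a k) (h : dyadicSum p a < ⊤) :
    MemBesov p (gapSeries a) := by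
  have hs := summable_dy_mul hp ha h
  obtain ⟨C, hC, hle⟩ := exists_lintegral_lacunary_le hp
  refine memBesov_of_radialIntegral_le hp (differentiableOn_gapSeries ha hs)
    (ENNReal.mul_ne_top hC h.ne) fun θ => ?_
  refine hle a (fun k => (a k : ℂ) * Complex.exp (θ * Complex.I) ^ (2 ^ k - 1)) _ ha
    (norm_coeff_twist ha θ _) fun r hr => ?_
  refine (hasSum_deriv_gapSeries ha hs (circleMap_zero_mem_ball hr θ)).congr_fun fun k => ?_
  rw [circleMap, zero_add, mul_pow]
  ring

/-- The factor z turns the exponents 2^k - 1 into 2^k, the form in which dilations produce the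
kernel x(1-x)^n. -/
lemma radialIntegral_mul_deriv_gapSeries {q : ℝ} (hq : 1 ≤ q) (ha : ∀ k, 0 ≤ a k)
    (hmono : Monotone a) (hs : Summable fun k => dy k * a k) (htop : dyadicSum q a = ⊤) (θ : ℝ) :
    radialIntegral q
      (fun r => ‖circleMap 0 r θ * deriv (gapSeries a) (circleMap 0 r θ)‖) = ⊤ := by
  refine radialIntegral_lacunary_eq_top hq
    (c := fun k => (a k : ℂ) * Complex.exp (θ * Complex.I) ^ (2 ^ k)) ha hmono
    (norm_coeff_twist ha θ _) hs (fun r hr => ?_) ?_ htop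
  · refine ((hasSum_deriv_gapSeries ha hs (circleMap_zero_mem_ball hr θ)).mul_left
      (circleMap 0 r θ)).congr_fun fun k => ?_
    have h2 : circleMap 0 r θ * circleMap 0 r θ ^ (2 ^ k - 1) = circleMap 0 r θ ^ (2 ^ k) := by
      rw [← pow_succ', Nat.sub_add_cancel Nat.one_le_two_pow]
    rw [mul_left_comm, h2, circleMap, zero_add, mul_pow]
    ring
  · have hc : Continuous fun r : ℝ => circleMap 0 r θ := by unfold circleMap; fun_prop
    exact hc.continuousOn.mul ((differentiableOn_deriv_gapSeries ha hs).continuousOn.comp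
      hc.continuousOn fun r hr => circleMap_zero_mem_ball hr θ)

lemma radialIntegral_deriv_gapSeries {q : ℝ} (hq : 1 ≤ q) (ha : ∀ k, 0 ≤ a k)
    (hmono : Monotone a) (hs : Summable fun k => dy k * a k) (htop : dyadicSum q a = ⊤) (θ : ℝ) :
    radialIntegral q (fun r => ‖deriv (gapSeries a) (circleMap 0 r θ)‖) = ⊤ := by
  rw [← top_le_iff, ← radialIntegral_mul_deriv_gapSeries hq ha hmono hs htop θ]
  refine setLIntegral_mono' measurableSet_Ico fun r hr => ENNReal.ofReal_le_ofReal ?_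
  have h1 : 0 ≤ (1 - r) ^ (q - 2) := Real.rpow_nonneg (by linarith [hr.2]) _
  have h2 : ‖circleMap 0 r θ‖ ≤ 1 := (mem_ball_zero_iff.1 (circleMap_zero_mem_ball hr θ)).le
  gcongr
  beta_reduce
  rw [norm_mul]
  exact mul_le_of_le_one_left (norm_nonneg _) h2

end

/-- The coefficient of index `n + 1` is seen by the integral means on `[1 - 2^{-n}, 1 - 2^{-n-1})`
for `n ≥ 1`. -/
lemma inv_le_pow_of_mem_dyIco {n : ℕ} {r : ℝ} (hr : r ∈ dyIco (n + 1)) :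
    1 / 16 ≤ r ^ (2 ^ (n + 2) - 1) := by
  have hr' := dyIco_subset _ hr
  have h1 := hr.1
  have hb := one_add_mul_le_pow (a := r - 1) (by linarith [hr'.1]) (2 ^ n)
  rw [add_sub_cancel] at hb
  push_cast at hb
  have h3 := dy_mul_two_pow n
  rw [dy_succ] at h1
  have h4 : (2 : ℝ) ^ n * (1 - r) ≤ 2 ^ n * (dy n / 2) := by gcongr; linarith
  have h2 : 1 / 2 ≤ r ^ (2 ^ n) := by linarith
  calc (1 / 16 : ℝ) = (1 / 2) ^ 4 := by norm_num
    _ ≤ (r ^ (2 ^ n)) ^ 4 := pow_le_pow_left₀ (by norm_num) h2 4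
    _ = r ^ (2 ^ (n + 2)) := by rw [← pow_mul]; congr 1; ring
    _ ≤ _ := pow_le_pow_of_le_one hr'.1 hr'.2.le (Nat.sub_le _ _)

/-- On `[r₀, 1)` the integral means of the derivative dominate `φ`, provided some power of `r`
attached to a nonzero coefficient is bounded below on `[0, 1/2) ∩ [r₀, 1)`. -/
lemma exists_mul_le_integralMean {p : ℝ} (hp : 1 ≤ p) {φ : ℝ → ℝ}
    (hφ_pos : ∀ r ∈ Ico (0 : ℝ) 1, 0 < φ r) (hφ_mono : MonotoneOn φ (Ico (0 : ℝ) 1))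
    {a : ℕ → ℝ} (ha : ∀ k, 0 ≤ a k) (hs : Summable fun k => dy k * a k)
    (haφ : ∀ n, a (n + 1) = φ (1 - dy (n + 1))) {r₀ b : ℝ} (hr₀ : 0 ≤ r₀) (hb : 0 < b) (k : ℕ)
    (hk : ∀ r ∈ Ico r₀ 1, b ≤ a k * r ^ (2 ^ k - 1)) :
    ∃ C : ℝ, 0 < C ∧ ∀ r ∈ Ico r₀ 1, C * φ r ≤ integralMean p r (deriv (gapSeries a)) := by
  have hpos := hφ_pos _ (one_sub_dy_mem 1)
  -- The first constant serves the blocks n ≥ 1; the second serves [0, 1/2), where φ ≤ φ(1/2) and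
  -- the term of index k is used.
  refine ⟨min (1 / 16) (b / φ (1 - dy 1)), by positivity, fun r hr => ?_⟩
  have hr' : r ∈ Ico (0 : ℝ) 1 := ⟨hr₀.trans hr.1, hr.2⟩
  obtain ⟨n, hn⟩ := mem_iUnion.1 (iUnion_dyIco ▸ hr')
  have hφr := hφ_pos r hr'
  have hle : φ r ≤ a (n + 1) := by
    rw [haφ]; exact hφ_mono hr' (one_sub_dy_mem _) hn.2.le
  rcases n with _ | n
  · refine le_trans ?_ ((hk r hr).trans (coeff_mul_pow_le_integralMean hp ha hs hr' k))
    rw [haφ] at hle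
    calc _ ≤ b / φ (1 - dy 1) * φ (1 - dy 1) :=
          mul_le_mul (min_le_right _ _) hle hφr.le (by positivity)
      _ = b := by field_simp
  · refine le_trans ?_ (coeff_mul_pow_le_integralMean hp ha hs hr' (n + 2))
    have h1 := inv_le_pow_of_mem_dyIco hn
    calc _ ≤ 1 / 16 * a (n + 2) := mul_le_mul (min_le_left _ _) hle hφr.le (by norm_num)
      _ = a (n + 2) * (1 / 16) := mul_comm _ _
      _ ≤ _ := mul_le_mul_of_nonneg_left h1 (ha _)

/-- The conclusions common to both series: only the coefficients of positive index have to be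
samples of `φ`. -/
lemma gapSeries_properties {p q : ℝ} (hq : 1 < q) (hqp : q < p) {φ : ℝ → ℝ}
    (hφ_pos : ∀ r ∈ Ico (0 : ℝ) 1, 0 < φ r) (hφ_mono : MonotoneOn φ (Ico (0 : ℝ) 1))
    (hφ_p : radialIntegral p φ < ⊤) (hφ_q : radialIntegral q φ = ⊤) {a : ℕ → ℝ}
    (ha0 : 0 ≤ a 0) (ha0' : a 0 ≤ φ 0) (haφ : ∀ n, a (n + 1) = φ (1 - dy (n + 1))) :
    (∀ k, 0 ≤ a k) ∧ (Summable fun k => dy k * a k) ∧ MemBesov p (gapSeries a) ∧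
      MemHInfty (gapSeries a) ∧ ¬ MemBesov q (gapSeries a) ∧
      ∀ θ : ℝ, radialIntegral q (fun r => ‖deriv (gapSeries a) (circleMap 0 r θ)‖) = ⊤ := by
  have ha : ∀ k, 0 ≤ a k
    | 0 => ha0
    | k + 1 => by rw [haφ]; exact (hφ_pos _ (one_sub_dy_mem _)).le
  have hle : ∀ k, a k ≤ φ (1 - dy k)
    | 0 => by simpa [dy_zero] using ha0'
    | k + 1 => (haφ k).le
  have hmono : Monotone a := monotone_nat_of_le_succ fun n => by
    rw [haφ]
    exact (hle n).trans (hφ_mono (one_sub_dy_mem _) (one_sub_dy_mem _)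
      (monotone_one_sub_dy n.le_succ))
  have hp : dyadicSum p a < ⊤ :=
    (dyadicSum_le_radialIntegral (by linarith) ha fun n r hr =>
      (hle n).trans (hφ_mono (one_sub_dy_mem n) (dyIco_subset n hr) hr.1)).trans_lt
        (ENNReal.mul_lt_top (by simp) hφ_p)
  have hqt : dyadicSum q a = ⊤ := by
    by_contra h
    refine absurd hφ_q (ne_of_lt ?_)
    -- Only the samples of positive index bound φ from above, so the value of a 0 plays no role.
    refine (radialIntegral_le_tsum (a := fun n => a (n + 1)) (by linarith)
      (fun r hr => (hφ_pos r hr).le) fun n r hr => ?_).trans_lt (ENNReal.mul_lt_top (by simp)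
        ((dyadicSum_shift_le q a).trans_lt (ENNReal.mul_lt_top (by simp)
          (lt_top_iff_ne_top.2 h))))
    rw [haφ]
    exact hφ_mono (dyIco_subset n hr) (one_sub_dy_mem _) hr.2.le
  have hs := summable_dy_mul (hq.trans hqp) ha hp
  exact ⟨ha, hs, memBesov_gapSeries (hq.trans hqp) ha hp, memHInfty_gapSeries ha hs,
    not_memBesov_of_radialIntegral_eq_top hq
      (radialIntegral_mul_deriv_gapSeries hq.le ha hmono hs hqt),
    radialIntegral_deriv_gapSeries hq.le ha hmono hs hqt⟩

end

theorem theorem1 (p q : ℝ) (hq : 1 < q) (hqp : q < p) (φ : ℝ → ℝ)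
    (hφ_pos : ∀ r ∈ Set.Ico (0 : ℝ) 1, 0 < φ r)
    (hφ_mono : MonotoneOn φ (Set.Ico (0 : ℝ) 1))
    (hφ_p : radialIntegral p φ < ⊤)
    (hφ_q : radialIntegral q φ = ⊤) :
    -- the series over all `k ≥ 0`, with the lower bound on the whole of `[0, 1)`
    (∃ f : ℂ → ℂ,
      (∀ z ∈ Metric.ball (0 : ℂ) 1, HasSum (fun k : ℕ => gapTerm φ k z) (f z)) ∧
      MemBesov p f ∧ MemHInfty f ∧ ¬ MemBesov q f ∧
      (∃ C : ℝ, 0 < C ∧ ∀ r ∈ Set.Ico (0 : ℝ) 1, C * φ r ≤ integralMean p r (deriv f)) ∧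
      (∀ θ : ℝ, radialIntegral q (fun r => ‖deriv f (circleMap 0 r θ)‖) = ⊤)) ∧
    -- the series over `k ≥ 1`, whose derivative vanishes at `0`: the lower bound away from `r = 0`
    (∃ f : ℂ → ℂ,
      (∀ z ∈ Metric.ball (0 : ℂ) 1, HasSum (fun k : ℕ => gapTerm φ (k + 1) z) (f z)) ∧
      MemBesov p f ∧ MemHInfty f ∧ ¬ MemBesov q f ∧
      (∀ r₀ : ℝ, 0 < r₀ → ∃ C : ℝ, 0 < C ∧
        ∀ r ∈ Set.Ico r₀ 1, C * φ r ≤ integralMean p r (deriv f)) ∧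
      (∀ θ : ℝ, radialIntegral q (fun r => ‖deriv f (circleMap 0 r θ)‖) = ⊤)) := by
  have hp : 1 ≤ p := by linarith
  have hφ0 := hφ_pos 0 (by simp)
  constructor
  · set a : ℕ → ℝ := fun k => φ (1 - dy k) with haφ
    have ha0 : a 0 = φ 0 := by simp [haφ, dy_zero]
    obtain ⟨ha, hs, hBp, hH, hBq, hrad⟩ := gapSeries_properties hq hqp hφ_pos hφ_mono hφ_p hφ_q
      (a := a) (ha0 ▸ hφ0.le) ha0.le fun _ => rfl
    refine ⟨gapSeries a, fun z hz => hasSum_gapSeries ha hs hz, hBp, hH, hBq, ?_, hrad⟩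
    -- Index 0 has exponent 2^0 - 1 = 0, so its term is the constant φ(0), even at r = 0.
    exact exists_mul_le_integralMean hp hφ_pos hφ_mono ha hs (fun _ => rfl) le_rfl hφ0 0
      fun r _ => by simp [ha0]
  -- A zero coefficient at index 0 keeps the sequence nondecreasing and drops the term z.
  · set a : ℕ → ℝ := fun k => if k = 0 then 0 else φ (1 - dy k) with haφ
    have hsucc : ∀ n, a (n + 1) = φ (1 - dy (n + 1)) := fun n => by simp [haφ]
    have ha0 : a 0 = 0 := by simp [haφ]
    obtain ⟨ha, hs, hBp, hH, hBq, hrad⟩ := gapSeries_properties hq hqp hφ_pos hφ_mono hφ_p hφ_q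
      (a := a) ha0.ge (ha0 ▸ hφ0.le) hsucc
    refine ⟨gapSeries a, fun z hz => ?_, hBp, hH, hBq, fun r₀ hr₀ => ?_, hrad⟩
    · have h := (hasSum_nat_add_iff' 1).2 (hasSum_gapSeries ha hs hz)
      simp only [Finset.range_one, Finset.sum_singleton, ha0, mul_zero, Complex.ofReal_zero,
        zero_mul, sub_zero, hsucc] at h
      exact h
    · refine exists_mul_le_integralMean hp hφ_pos hφ_mono ha hs hsucc hr₀.le
        (b := φ (1 - dy 1) * r₀) (mul_pos (hφ_pos _ (one_sub_dy_mem 1)) hr₀) 1 fun r hr => ?_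
      rw [hsucc 0]
      have := (hφ_pos _ (one_sub_dy_mem 1)).le
      simpa using mul_le_mul_of_nonneg_left hr.1 this
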